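/- Let $K$ be a field of characteristic $0$ and $a,b,c\in K^\times$. For $n\ge 0$ let $B_n$ be the braid group on $n$ strands with Artin generators $s_1,\dots,s_{n-1}$ (trivial for $n\le 1$). - For $x,y\in K^\times$, $J_n(x,y)\subset KB_n$ is the two-sided ideal generated by the elements $(s_i-x)(s_i-y)$, $1\le i\le n-1$, and $\mathcal H_n=KB_n/\bigl(J_n(a,b)\cap J_n(a,c)\cap J_n(b,c)\bigr)$. - $H_n=H_n(a,b,c)$ is the quotient of $KB_n$ by the relations $(s_i-a)(s_i-b)(s_i-c)=0$, $1\le i\le n-1$. - $\mathbf b=[s_2^2,s_1]-[s_2,s_1^2]$ (for $n\ge 3$), and $\mathcal K_n=H_n/(\mathbf b)$; for $n\le 2$, $\mathcal K_n=H_n$. The identity of $KB_n$ induces a natural surjective morphism $\mathcal K_n\to\mathcal H_n$. - $V$ is the representation of $H_3$ on $K^3$ given by $$s_1\mapsto\begin{pmatrix}c&0&0\\ ac+b^2&b&0\\ b&1&a\end{pmatrix},\qquad s_2\mapsto\begin{pmatrix}a&-1&b\\ 0&b&-ac-b^2\\ 0&0&c\end{pmatrix}.$$ Assume that $a,b,c$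 are generic, meaning that either $a,b,c$ are algebraically independent over $\mathbb Q$, or $a,b,c$ are pairwise distinct and the algebras $H_3$ and $H_4$ are split semisimple over $K$ (finite products of matrix algebras over $K$). Then: 1. $V$ is irreducible, and the two-sided ideal of $H_3$ generated by $\mathbf b$ is the indecomposable ideal (block) of $H_3$ attached to $V$, that is, the ideal generated by a primitive idempotent of the centre of $H_3$ which acts as the identity on $V$. 2. For every $n\le 4$ the natural morphism $\mathcal K_n\to\mathcal H_n$ is an isomorphism. Moreover $\dim_K\mathcal K_3=15$ and $\dim_K\mathcal K_4=69$. 3. Put $\Sigma_1=a+b+c$, $\Sigma_2=ab+bc+ac$, $\Sigma_3=abc$. In $\mathcal K_3$ one has $(s_i-a)(s_i-b)(s_i-c)=0$ for $i=1,2$; $[s_2^2,s_1]=[s_2,s_1^2]$; and $$s_2s_1^2s_2=-\Sigma_3s_1+\Sigma_2s_1s_2+s_1s_2s_1^2-\Sigma_1s_1s_2^2+s_1^2s_2^2.$$ In $\mathcal K_4$ one has $$s_2s_3^2=-s_1^2s_3+s_1^2s_2+s_2^2s_3-s_1s_2^2+s_1s_3^2,$$ $$s_2^2s_3s_1=s_2s_1^2s_3-s_1^2s_2s_3+s_1s_2^2s_3,$$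 $$\begin{aligned}s_2^2s_3^2={}&-\Sigma_3s_1+\Sigma_2s_1s_3-\Sigma_1s_1^2s_3+\Sigma_3s_2-\Sigma_2s_2s_3+\Sigma_1s_1^2s_2-s_1^2s_2s_3\\&+\Sigma_1s_2^2s_3-\Sigma_1s_1s_2^2+s_1s_2^2s_3+s_1^2s_3^2,\end{aligned}$$ $$\begin{aligned}s_2^2s_3^2={}&-\Sigma_3s_1+\Sigma_2s_1s_3-\Sigma_1s_1^2s_3+\Sigma_3s_2-\Sigma_2s_2s_3+\Sigma_1s_1^2s_2+\Sigma_1s_2^2s_3\\&-\Sigma_1s_1s_2^2+s_1^2s_3^2+s_2^2s_1s_3-s_2s_1^2s_3.\end{aligned}$$ -/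

import Mathlib

noncomputable section

namespace CubicHecke

/-! ### Braid groups and their group algebras -/

/-- Artin's relations between the generators `s_1, ..., s_{n-1}`; the generator `s_{i+1}` is
indexed by `i : Fin (n - 1)`. -/
inductive BraidRelation (n : ℕ) : FreeGroup (Fin (n - 1)) → Prop
  | braid (i j : Fin (n - 1)) (h : (i : ℕ) + 1 = j) :
      BraidRelation n (FreeGroup.of i * FreeGroup.of j * FreeGroup.of i *
        (FreeGroup.of j * FreeGroup.of i * FreeGroup.of j)⁻¹)
  | comm (i j : Fin (n - 1)) (h : (i : ℕ) + 1 < j) :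
      BraidRelation n (FreeGroup.of i * FreeGroup.of j *
        (FreeGroup.of j * FreeGroup.of i)⁻¹)

/-- The braid group `B_n` on `n` strands. -/
abbrev BraidGroup (n : ℕ) : Type := PresentedGroup {w | BraidRelation n w}

/-- The group algebra `R B_n`. -/
abbrev BraidAlgebra (R : Type*) [CommRing R] (n : ℕ) : Type _ := MonoidAlgebra R (BraidGroup n)

/-- The Artin generator `s_{i+1}`, seen in the group algebra `R B_n`. -/
def gen (R : Type*) [CommRing R] (n : ℕ) (i : Fin (n - 1)) : BraidAlgebra R n :=
  MonoidAlgebra.of R (BraidGroup n) (PresentedGroup.of i)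

section Algebras

variable {R : Type*} [CommRing R]

/-! ### The quadratic Hecke algebras and the tripled algebra -/

/-- `J_n(x, y)`: the two-sided ideal of `R B_n` generated by the `(s_i - x)(s_i - y)`. -/
def quadraticIdeal (n : ℕ) (x y : R) : TwoSidedIdeal (BraidAlgebra R n) :=
  TwoSidedIdeal.span (Set.range fun i : Fin (n - 1) =>
    (gen R n i - algebraMap R _ x) * (gen R n i - algebraMap R _ y))

/-- `J_n(a, b) ∩ J_n(a, c) ∩ J_n(b, c)`. -/
def tripledIdeal (n : ℕ) (a b c : Rˣ) : TwoSidedIdeal (BraidAlgebra R n) :=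
  quadraticIdeal n (a : R) b ⊓ quadraticIdeal n (a : R) c ⊓ quadraticIdeal n (b : R) c

/-- The tripled quadratic Hecke algebra `𝓗_n(a, b, c)`. -/
def Tripled (n : ℕ) (a b c : Rˣ) : Type _ := (tripledIdeal n a b c).ringCon.Quotient

instance (n : ℕ) (a b c : Rˣ) : Ring (Tripled n a b c) :=
  inferInstanceAs (Ring (tripledIdeal n a b c).ringCon.Quotient)

instance (n : ℕ) (a b c : Rˣ) : Algebra R (Tripled n a b c) :=
  inferInstanceAs (Algebra R (tripledIdeal n a b c).ringCon.Quotient)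

/-- The projection `R B_n → 𝓗_n(a, b, c)`. -/
def tripledMk (n : ℕ) (a b c : Rˣ) : BraidAlgebra R n →ₐ[R] Tripled n a b c :=
  (tripledIdeal n a b c).ringCon.mkₐ R

/-! ### The cubic Hecke algebra and its quotient by `𝐛` -/

/-- The two-sided ideal of `R B_n` generated by the `(s_i - a)(s_i - b)(s_i - c)`. -/
def cubicIdeal (n : ℕ) (a b c : Rˣ) : TwoSidedIdeal (BraidAlgebra R n) :=
  TwoSidedIdeal.span (Set.range fun i : Fin (n - 1) =>
    (gen R n i - algebraMap R _ (a : R)) * (gen R n i - algebraMap R _ (b : R)) *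
      (gen R n i - algebraMap R _ (c : R)))

/-- The cubic Hecke algebra `H_n(a, b, c)`. -/
def Cubic (n : ℕ) (a b c : Rˣ) : Type _ := (cubicIdeal n a b c).ringCon.Quotient

instance (n : ℕ) (a b c : Rˣ) : Ring (Cubic n a b c) :=
  inferInstanceAs (Ring (cubicIdeal n a b c).ringCon.Quotient)

instance (n : ℕ) (a b c : Rˣ) : Algebra R (Cubic n a b c) :=
  inferInstanceAs (Algebra R (cubicIdeal n a b c).ringCon.Quotient)

/-- The projection `R B_n → H_n(a, b, c)`. -/
def cubicMk (n : ℕ) (a b c : Rˣ) : BraidAlgebra R n →ₐ[R] Cubic n a b c :=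
  (cubicIdeal n a b c).ringCon.mkₐ R

/-- The class of the generator `s_{i+1}` in `H_n(a, b, c)`. -/
def cubicGen (n : ℕ) (a b c : Rˣ) (i : Fin (n - 1)) : Cubic n a b c :=
  cubicMk n a b c (gen R n i)

/-- `[t², s] - [t, s²]`, which for `s = s_1` and `t = s_2` is the element `𝐛`. -/
def bElement {A : Type*} [Ring A] (s t : A) : A := ⁅t ^ 2, s⁆ - ⁅t, s ^ 2⁆

/-- The two-sided ideal `(𝐛)` of `H_n(a, b, c)`. The element `𝐛` involves `s_1` and `s_2`, so that
for `n ≤ 2` there is no generator and the ideal is zero. -/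
def bIdeal (n : ℕ) (a b c : Rˣ) : TwoSidedIdeal (Cubic n a b c) :=
  TwoSidedIdeal.span {z | ∃ h : 3 ≤ n,
    z = bElement (cubicGen n a b c ⟨0, by omega⟩) (cubicGen n a b c ⟨1, by omega⟩)}

/-- The algebra `𝓚_n(a, b, c) = H_n(a, b, c) / (𝐛)`. -/
def KAlg (n : ℕ) (a b c : Rˣ) : Type _ := (bIdeal n a b c).ringCon.Quotient

instance (n : ℕ) (a b c : Rˣ) : Ring (KAlg n a b c) :=
  inferInstanceAs (Ring (bIdeal n a b c).ringCon.Quotient)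

instance (n : ℕ) (a b c : Rˣ) : Algebra R (KAlg n a b c) :=
  inferInstanceAs (Algebra R (bIdeal n a b c).ringCon.Quotient)

/-- The projection `H_n(a, b, c) → 𝓚_n(a, b, c)`. -/
def kMk (n : ℕ) (a b c : Rˣ) : Cubic n a b c →ₐ[R] KAlg n a b c :=
  (bIdeal n a b c).ringCon.mkₐ R

/-- The class of the generator `s_{i+1}` in `𝓚_n(a, b, c)`. -/
def kGen (n : ℕ) (a b c : Rˣ) (i : Fin (n - 1)) : KAlg n a b c :=
  kMk n a b c (cubicGen n a b c i)

/-! ### The natural morphism from `𝓚_n` to `𝓗_n` -/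

/-- If `f` kills the set `s` then it factors through the quotient by the ideal generated by `s`. -/
theorem span_ringCon_le_ker {A B : Type*} [Ring A] [Ring B] (s : Set A) (f : A →+* B)
    (h : ∀ z ∈ s, f z = 0) : (TwoSidedIdeal.span s).ringCon ≤ RingCon.ker f := by
  have h1 : TwoSidedIdeal.span s ≤ TwoSidedIdeal.ker f :=
    TwoSidedIdeal.span_le.2 fun z hz => (TwoSidedIdeal.mem_ker f).2 (h z hz)
  intro x y hxy
  have h2 : x - y ∈ TwoSidedIdeal.span s := (TwoSidedIdeal.rel_iff _ x y).1 hxy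
  have h3 := (TwoSidedIdeal.mem_ker f).1 (h1 h2)
  rw [map_sub, sub_eq_zero] at h3
  exact h3

/-- An element maps to zero in the quotient by a two-sided ideal if and only if it lies in it. -/
theorem mk_eq_zero_iff {A : Type*} [Ring A] [Algebra R A] (I : TwoSidedIdeal A) (z : A) :
    I.ringCon.mkₐ R z = 0 ↔ z ∈ I := by
  rw [TwoSidedIdeal.mem_iff]
  exact RingCon.eq I.ringCon

theorem bElement_eq_zero_of_quadratic {A : Type*} [Ring A] [Algebra R A] (s t : A) (x y : R)
    (hs : (s - algebraMap R A x) * (s - algebraMap R A y) = 0)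
    (ht : (t - algebraMap R A x) * (t - algebraMap R A y) = 0) : bElement s t = 0 := by
  have key : ∀ u : A, (u - algebraMap R A x) * (u - algebraMap R A y) = 0 →
      u ^ 2 = (x + y) • u - algebraMap R A (x * y) := by
    intro u hu
    have h : (u - algebraMap R A x) * (u - algebraMap R A y) =
        u ^ 2 - (x + y) • u + algebraMap R A (x * y) := by
      rw [sub_mul, mul_sub, mul_sub, ← Algebra.commutes y u, ← map_mul,
        Algebra.smul_def, map_add, add_mul, pow_two]
      abel
    rw [h] at hu
    rw [← sub_eq_zero, ← hu]
    abel
  have c1 := Algebra.commutes (x * y) s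
  have c2 := Algebra.commutes (x * y) t
  rw [bElement, key s hs, key t ht]
  simp only [Ring.lie_def, sub_mul, mul_sub, smul_mul_assoc, mul_smul_comm, c1, c2]
  abel

theorem bElement_mem_quadraticIdeal (n : ℕ) (x y : R) (i j : Fin (n - 1)) :
    bElement (gen R n i) (gen R n j) ∈ quadraticIdeal n x y := by
  rw [← mk_eq_zero_iff (R := R)]
  set f := (quadraticIdeal n x y).ringCon.mkₐ R with hf
  have hb : f (bElement (gen R n i) (gen R n j)) = bElement (f (gen R n i)) (f (gen R n j)) := by
    simp [bElement, Ring.lie_def]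
  have hq : ∀ k, (f (gen R n k) - algebraMap R _ x) * (f (gen R n k) - algebraMap R _ y) = 0 := by
    intro k
    have h : f ((gen R n k - algebraMap R _ x) * (gen R n k - algebraMap R _ y)) = 0 :=
      (mk_eq_zero_iff _ _).2 (TwoSidedIdeal.subset_span ⟨k, rfl⟩)
    rw [map_mul, map_sub, map_sub, AlgHom.commutes, AlgHom.commutes] at h
    exact h
  rw [hb]
  exact bElement_eq_zero_of_quadratic _ _ x y (hq i) (hq j)

theorem cubic_mem_tripledIdeal (n : ℕ) (a b c : Rˣ) (i : Fin (n - 1)) :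
    (gen R n i - algebraMap R _ (a : R)) * (gen R n i - algebraMap R _ (b : R)) *
      (gen R n i - algebraMap R _ (c : R)) ∈ tripledIdeal n a b c := by
  have hcomm : ∀ x y : R, Commute (gen R n i - algebraMap R (BraidAlgebra R n) x)
      (gen R n i - algebraMap R (BraidAlgebra R n) y) := by
    intro x y
    refine Commute.sub_left (Commute.sub_right (Commute.refl _) ?_) ?_
    · exact (Algebra.commutes y _).symm
    · exact Algebra.commutes x _
  have hmem : ∀ x y : R, (gen R n i - algebraMap R _ x) * (gen R n i - algebraMap R _ y) ∈
      quadraticIdeal n x y := fun x y => TwoSidedIdeal.subset_span ⟨i, rfl⟩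
  refine ⟨⟨?_, ?_⟩, ?_⟩
  · exact TwoSidedIdeal.mul_mem_right _ _ _ (hmem _ _)
  · rw [mul_assoc, (hcomm b c).eq, ← mul_assoc]
    exact TwoSidedIdeal.mul_mem_right _ _ _ (hmem _ _)
  · rw [mul_assoc]
    exact TwoSidedIdeal.mul_mem_left _ _ _ (hmem _ _)

/-- The natural morphism `H_n → 𝓗_n`, induced by the identity of `R B_n`. -/
def cubicToTripled (n : ℕ) (a b c : Rˣ) : Cubic n a b c →ₐ[R] Tripled n a b c :=
  RingCon.liftₐ (cubicIdeal n a b c).ringCon (tripledMk n a b c) <| span_ringCon_le_ker _ _ <| by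
    rintro _ ⟨i, rfl⟩
    exact (mk_eq_zero_iff _ _).2 (cubic_mem_tripledIdeal n a b c i)

theorem cubicToTripled_bElement (n : ℕ) (a b c : Rˣ) (i j : Fin (n - 1)) :
    cubicToTripled n a b c (bElement (cubicGen n a b c i) (cubicGen n a b c j)) = 0 := by
  have h : tripledMk n a b c (bElement (gen R n i) (gen R n j)) = 0 :=
    (mk_eq_zero_iff _ _).2 ⟨⟨bElement_mem_quadraticIdeal n _ _ i j,
      bElement_mem_quadraticIdeal n _ _ i j⟩, bElement_mem_quadraticIdeal n _ _ i j⟩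
  exact h

/-- The natural morphism `𝓚_n → 𝓗_n`, induced by the identity of `R B_n`. -/
def toTripled (n : ℕ) (a b c : Rˣ) : KAlg n a b c →ₐ[R] Tripled n a b c :=
  RingCon.liftₐ (bIdeal n a b c).ringCon (cubicToTripled n a b c) <| span_ringCon_le_ker _ _ <| by
    rintro _ ⟨_, rfl⟩
    exact cubicToTripled_bElement n a b c _ _

/-! ### The three-dimensional representation `V` of `H_3` -/

/-- The matrix of `s_1` on `V`. -/
def vMatrix₁ (a b c : R) : Matrix (Fin 3) (Fin 3) R :=
  !![c, 0, 0; a * c + b ^ 2, b, 0; b, 1, a]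

/-- The matrix of `s_2` on `V`. -/
def vMatrix₂ (a b c : R) : Matrix (Fin 3) (Fin 3) R :=
  !![a, -1, b; 0, b, -(a * c) - b ^ 2; 0, 0, c]

/-- The images of `s_1` and `s_2` in `GL_3(R)`. -/
def vUnit (a b c : Rˣ) (i : Fin (3 - 1)) : (Matrix (Fin 3) (Fin 3) R)ˣ :=
  if (i : ℕ) = 0 then
    Matrix.nonsingInvUnit (vMatrix₁ (a : R) b c) (by
      have h : (vMatrix₁ (a : R) b c).det = ((c * b * a : Rˣ) : R) := by
        simp [vMatrix₁, Matrix.det_fin_three]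
      rw [h]
      exact Units.isUnit _)
  else
    Matrix.nonsingInvUnit (vMatrix₂ (a : R) b c) (by
      have h : (vMatrix₂ (a : R) b c).det = ((a * b * c : Rˣ) : R) := by
        simp [vMatrix₂, Matrix.det_fin_three]
      rw [h]
      exact Units.isUnit _)

theorem vUnit_val (a b c : Rˣ) (i : Fin (3 - 1)) : (vUnit a b c i : Matrix (Fin 3) (Fin 3) R) =
    if (i : ℕ) = 0 then vMatrix₁ (a : R) b c else vMatrix₂ (a : R) b c := by
  unfold vUnit
  split_ifs <;> rfl

theorem vMatrix_braid (a b c : R) :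
    vMatrix₁ a b c * vMatrix₂ a b c * vMatrix₁ a b c =
      vMatrix₂ a b c * vMatrix₁ a b c * vMatrix₂ a b c := by
  ext i j
  fin_cases i <;> fin_cases j <;>
    simp [vMatrix₁, vMatrix₂, Matrix.mul_apply, Fin.sum_univ_three] <;> ring

theorem vMatrix₁_cubic (a b c : R) :
    (vMatrix₁ a b c - algebraMap R _ a) * (vMatrix₁ a b c - algebraMap R _ b) *
      (vMatrix₁ a b c - algebraMap R _ c) = 0 := by
  ext i j
  fin_cases i <;> fin_cases j <;>
    simp [vMatrix₁, Matrix.mul_apply, Fin.sum_univ_three, Matrix.algebraMap_matrix_apply]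

theorem vMatrix₂_cubic (a b c : R) :
    (vMatrix₂ a b c - algebraMap R _ a) * (vMatrix₂ a b c - algebraMap R _ b) *
      (vMatrix₂ a b c - algebraMap R _ c) = 0 := by
  ext i j
  fin_cases i <;> fin_cases j <;>
    simp [vMatrix₂, Matrix.mul_apply, Fin.sum_univ_three, Matrix.algebraMap_matrix_apply]

/-- `V` as a representation of the braid group `B_3`. -/
def vBraid (a b c : Rˣ) : BraidGroup 3 →* (Matrix (Fin 3) (Fin 3) R)ˣ :=
  PresentedGroup.toGroup (f := vUnit a b c) <| by
    rintro _ (⟨i, j, h⟩ | ⟨i, j, h⟩)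
    · have hi : (i : ℕ) = 0 := by omega
      have hj : (j : ℕ) ≠ 0 := by omega
      simp only [map_mul, map_inv, FreeGroup.lift_apply_of]
      rw [mul_inv_eq_one]
      ext1
      simpa [vUnit_val, hi, hj] using vMatrix_braid (a : R) b c
    · omega

/-- `V` as a representation of the group algebra `R B_3`. -/
def vAlg (a b c : Rˣ) : BraidAlgebra R 3 →ₐ[R] Matrix (Fin 3) (Fin 3) R :=
  MonoidAlgebra.lift R (Matrix (Fin 3) (Fin 3) R) (BraidGroup 3)
    ((Units.coeHom _).comp (vBraid a b c))

theorem vAlg_gen (a b c : Rˣ) (i : Fin (3 - 1)) :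
    vAlg a b c (gen R 3 i) = if (i : ℕ) = 0 then vMatrix₁ (a : R) b c else vMatrix₂ (a : R) b c := by
  have h : vBraid a b c (PresentedGroup.of i) = vUnit a b c i := PresentedGroup.toGroup.of _
  simp only [vAlg, gen, MonoidAlgebra.lift_of, MonoidHom.comp_apply, Units.coeHom_apply, h, vUnit_val]

/-- The representation `V` of `H_3(a, b, c)`. -/
def V (a b c : Rˣ) : Cubic 3 a b c →ₐ[R] Matrix (Fin 3) (Fin 3) R :=
  RingCon.liftₐ (cubicIdeal 3 a b c).ringCon (vAlg a b c) <| span_ringCon_le_ker _ _ <| by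
    rintro _ ⟨i, rfl⟩
    change vAlg a b c _ = 0
    simp only [map_mul, map_sub, AlgHom.commutes, vAlg_gen]
    split_ifs
    · exact vMatrix₁_cubic _ _ _
    · exact vMatrix₂_cubic _ _ _

end Algebras

/-! ### Blocks, split semisimple algebras, genericity -/

/-- The matrix representation `ρ` of `A` on `Kᵐ` is irreducible. -/
def IsIrreducible {K A : Type*} [Field K] [Ring A] [Algebra K A] {m : ℕ}
    (ρ : A →ₐ[K] Matrix (Fin m) (Fin m) K) : Prop :=
  0 < m ∧ ∀ W : Submodule K (Fin m → K),
    (∀ x : A, ∀ w ∈ W, (ρ x).mulVec w ∈ W) → W = ⊥ ∨ W = ⊤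

/-- `I` is the indecomposable two-sided ideal (block) of `A` attached to the representation `ρ`:
it is generated by a primitive idempotent of the centre of `A` which acts as the identity
through `ρ`. -/
def IsBlockOf {K A : Type*} [Field K] [Ring A] [Algebra K A] {m : ℕ}
    (ρ : A →ₐ[K] Matrix (Fin m) (Fin m) K) (I : TwoSidedIdeal A) : Prop :=
  ∃ e : A, e ∈ Subring.center A ∧ IsIdempotentElem e ∧ e ≠ 0 ∧
    (∀ f ∈ Subring.center A, IsIdempotentElem f → f * e = f → f = 0 ∨ f = e) ∧
    ρ e = 1 ∧ I = TwoSidedIdeal.span {e}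

/-- A split semisimple `K`-algebra: a finite product of matrix algebras over `K`. -/
def IsSplitSemisimple (K A : Type*) [Field K] [Ring A] [Algebra K A] : Prop :=
  ∃ (r : ℕ) (d : Fin r → ℕ), (∀ i, 0 < d i) ∧
    Nonempty (A ≃ₐ[K] ((i : Fin r) → Matrix (Fin (d i)) (Fin (d i)) K))

/-- The parameters are generic: either they are algebraically independent over `ℚ`, or
they are pairwise distinct and `H_3(a, b, c)`, `H_4(a, b, c)` are split semisimple. -/
def IsGeneric {K : Type*} [Field K] [CharZero K] (a b c : Kˣ) : Prop :=
  AlgebraicIndependent ℚ ![(a : K), (b : K), (c : K)] ∨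
    ((a ≠ b ∧ a ≠ c ∧ b ≠ c) ∧
      IsSplitSemisimple K (Cubic 3 a b c) ∧ IsSplitSemisimple K (Cubic 4 a b c))

/-! ### The relations on three and four strands -/

/-- The relations on three strands, between elements `s₁, s₂` of a `K`-algebra. -/
structure Relations₃ {K A : Type*} [Field K] [Ring A] [Algebra K A] (a b c : K)
    (s₁ s₂ : A) : Prop where
  cubic₁ : (s₁ - algebraMap K A a) * (s₁ - algebraMap K A b) * (s₁ - algebraMap K A c) = 0
  cubic₂ : (s₂ - algebraMap K A a) * (s₂ - algebraMap K A b) * (s₂ - algebraMap K A c) = 0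
  bracket : ⁅s₂ ^ 2, s₁⁆ = ⁅s₂, s₁ ^ 2⁆
  ternary : s₂ * s₁ ^ 2 * s₂ = -((a * b * c) • s₁) + (a * b + b * c + a * c) • (s₁ * s₂) +
    s₁ * s₂ * s₁ ^ 2 - (a + b + c) • (s₁ * s₂ ^ 2) + s₁ ^ 2 * s₂ ^ 2

/-- The relations on four strands, between elements `s₁, s₂, s₃` of a `K`-algebra, with
`Σ₁ = a + b + c`, `Σ₂ = ab + bc + ac` and `Σ₃ = abc`. -/
structure Relations₄ {K A : Type*} [Field K] [Ring A] [Algebra K A] (a b c : K)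
    (s₁ s₂ s₃ : A) : Prop where
  rel₁ : s₂ * s₃ ^ 2 = -(s₁ ^ 2 * s₃) + s₁ ^ 2 * s₂ + s₂ ^ 2 * s₃ - s₁ * s₂ ^ 2 + s₁ * s₃ ^ 2
  rel₂ : s₂ ^ 2 * s₃ * s₁ = s₂ * s₁ ^ 2 * s₃ - s₁ ^ 2 * s₂ * s₃ + s₁ * s₂ ^ 2 * s₃
  rel₃ : s₂ ^ 2 * s₃ ^ 2 = -((a * b * c) • s₁) + (a * b + b * c + a * c) • (s₁ * s₃) -
    (a + b + c) • (s₁ ^ 2 * s₃) + (a * b * c) • s₂ - (a * b + b * c + a * c) • (s₂ * s₃) +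
    (a + b + c) • (s₁ ^ 2 * s₂) - s₁ ^ 2 * s₂ * s₃ + (a + b + c) • (s₂ ^ 2 * s₃) -
    (a + b + c) • (s₁ * s₂ ^ 2) + s₁ * s₂ ^ 2 * s₃ + s₁ ^ 2 * s₃ ^ 2
  rel₄ : s₂ ^ 2 * s₃ ^ 2 = -((a * b * c) • s₁) + (a * b + b * c + a * c) • (s₁ * s₃) -
    (a + b + c) • (s₁ ^ 2 * s₃) + (a * b * c) • s₂ - (a * b + b * c + a * c) • (s₂ * s₃) +
    (a + b + c) • (s₁ ^ 2 * s₂) + (a + b + c) • (s₂ ^ 2 * s₃) -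
    (a + b + c) • (s₁ * s₂ ^ 2) + s₁ ^ 2 * s₃ ^ 2 + s₂ ^ 2 * s₁ * s₃ - s₂ * s₁ ^ 2 * s₃

end CubicHecke

end

set_option linter.unusedSimpArgs false

noncomputable section

namespace CubicHecke

/-! ### Word rewriting in an algebra -/

section Words

variable {K A : Type*} [Field K] [Ring A] [Algebra K A] {m : ℕ}

/-! The dimensions are squeezed between an upper bound for `KAlg` and a lower bound for `Tripled`,
linked by the surjection `toTripled`; equality forces this surjection to be injective.

Upper bound. With the Artin generators ordered suitably, the defining relations yield reducible
words, and an algebra generated by the letters is spanned by the words avoiding them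
(`evalWord_mem_span`). Only spanning is needed, so confluence is never proved. The avoiding words
number 15 for `KAlg 3`, 69 for `KAlg 4` and 24 for `Cubic 3`. On four strands the decisive input is
`four_strand_relation`, a consequence of the braid relations and the vanishing of 𝐛 alone.

Lower bound. `Tripled n` acts on three regular representations of quadratic Hecke algebras, each of
dimension n!. The sum of two of the ideals J contains every s_i minus the common parameter, hence
has codimension at most one. The three orbit maps, taken successively on the kernels of the previous
ones, therefore have ranks at least n!, n! - 1 and n! - 2 (`le_finrank_tripled`), which gives 15 and
69 for n = 3, 4.

Block. Genericity makes V surjective onto the 3 × 3 matrices: through a nonzero determinant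
(`orbitDet_eq`) when the parameters are algebraically independent, through complete reducibility and
a scalar commutant (`eq_smul_one_of_commute`) when H_3 is split semisimple. The element 𝐛 dies in
`Tripled 3` but not in V. An element of the ideal (𝐛) acting as 1 on V thus maps to (0, 1) in the
product of `Tripled 3` and the matrices, so H_3 surjects onto this product; since 24 = 15 + 9 the
map is an isomorphism, and (𝐛) is the matrix factor (`isBlockOf_span_singleton`). -/

/-- The product in `A` of the letters of a word. -/
def evalWord (g : Fin m → A) (w : List (Fin m)) : A := (w.map g).prod

theorem evalWord_append (g : Fin m → A) (u v : List (Fin m)) :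
    evalWord g (u ++ v) = evalWord g u * evalWord g v := by
  simp [evalWord]

/-- The word `l` is, in `A`, a linear combination of words which are smaller in the
shortlex order. -/
def Reducible (K : Type*) {A : Type*} [Field K] [Ring A] [Algebra K A] {m : ℕ}
    (g : Fin m → A) (l : List (Fin m)) : Prop :=
  evalWord g l ∈ Submodule.span K (evalWord g '' {t | List.Shortlex (· < ·) t l})

/-- A certificate form of reducibility: with explicit coefficients and words, the shortlex condition
becomes decidable and only an identity in `A` remains. -/
theorem reducible_of_eq_sum (g : Fin m → A) (l : List (Fin m)) (cs : List K)
    (ts : List (List (Fin m)))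
    (hlt : ∀ t ∈ ts, t.length < l.length ∨ t.length = l.length ∧ t < l)
    (h : evalWord g l = (List.zipWith (fun c t => c • evalWord g t) cs ts).sum) :
    Reducible K g l := by
  rw [Reducible, h]
  refine list_sum_mem ?_
  intro x hx
  obtain ⟨i, hi, rfl⟩ := List.mem_iff_getElem.1 hx
  rw [List.getElem_zipWith]
  refine Submodule.smul_mem _ _ (Submodule.subset_span ⟨_, ?_, rfl⟩)
  exact List.shortlex_def.2 (hlt _ (List.getElem_mem _))

/-- The words of length `k` with no factor in the list `L`. -/
def normalWords (L : List (List (Fin m))) : ℕ → List (List (Fin m))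
  | 0 => [[]]
  | k + 1 => ((normalWords L k).flatMap fun w => (List.finRange m).map fun i => w ++ [i]).filter
      fun w => ∀ l ∈ L, ¬ l <:+ w

/-- Induction on the last letter: once the word without it is normal, a forbidden factor can only be
a suffix, which is why the filter in `normalWords` tests suffixes alone. -/
theorem mem_normalWords_or (L : List (List (Fin m))) (w : List (Fin m)) :
    w ∈ normalWords L w.length ∨ ∃ l ∈ L, l <:+: w := by
  induction w using List.reverseRecOn with
  | nil => simp [normalWords]
  | append_singleton w i ih =>
    rcases ih with h | ⟨l, hl, h⟩
    · by_cases hs : ∃ l ∈ L, l <:+ w ++ [i]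
      · obtain ⟨l, hl, h'⟩ := hs
        exact Or.inr ⟨l, hl, h'.isInfix⟩
      · left
        push Not at hs
        rw [List.length_append, List.length_singleton, normalWords, List.mem_filter]
        refine ⟨?_, by simpa using hs⟩
        simp only [List.mem_flatMap, List.mem_map]
        exact ⟨w, h, i, List.mem_finRange i, rfl⟩
    · exact Or.inr ⟨l, hl, h.trans (List.prefix_append _ _).isInfix⟩

theorem normalWords_eq_nil (L : List (List (Fin m))) {N k : ℕ} (hN : normalWords L N = [])
    (hk : N ≤ k) : normalWords L k = [] := by
  induction k, hk using Nat.le_induction with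
  | base => exact hN
  | succ k _ ih => simp [normalWords, ih]

/-- Between words of equal length the lexicographic comparison is decided at a position inside both,
so a common tail changes nothing; the proper prefix case, where this would fail, is excluded by
length. -/
theorem shortlex_append_append {s t : List (Fin m)} (h : List.Shortlex (· < ·) s t)
    (v : List (Fin m)) : List.Shortlex (· < ·) (s ++ v) (t ++ v) := by
  rcases List.shortlex_def.1 h with h | ⟨h, h'⟩
  · exact List.Shortlex.of_length_lt (by simpa using h)
  · refine List.Shortlex.of_lex (by simpa using h) ?_
    clear * - h h'
    induction h' with
    | nil => simp at h
    | cons _ ih => exact List.Lex.cons (ih (by simpa using h))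
    | rel hr => exact List.Lex.rel hr

/-- Well-founded induction along shortlex. A word u l v with l reducible is a combination of words u
t v with t smaller than l, and these are smaller because shortlex is compatible with concatenation.
Emptiness at the single length `N` excludes all longer normal words, which makes the spanning list
finite. -/
theorem evalWord_mem_span (g : Fin m → A) (L : List (List (Fin m))) (N : ℕ)
    (hN : normalWords L N = []) (hL : ∀ l ∈ L, Reducible K g l) (w : List (Fin m)) :
    evalWord g w ∈ Submodule.span K
      (evalWord g '' {t | t ∈ (List.range N).flatMap (normalWords L)}) := by
  induction w using (List.Shortlex.wf (r := ((· < ·) : Fin m → Fin m → Prop))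
    wellFounded_lt).induction with
  | _ w ih =>
    rcases mem_normalWords_or L w with h | ⟨l, hl, u, v, rfl⟩
    · refine Submodule.subset_span ⟨w, ?_, rfl⟩
      simp only [Set.mem_ofPred_eq, List.mem_flatMap, List.mem_range]
      refine ⟨w.length, ?_, h⟩
      by_contra hlt
      rw [normalWords_eq_nil L hN (not_lt.1 hlt)] at h
      simp at h
    · have key : ∀ x ∈ Submodule.span K (evalWord g '' {t | List.Shortlex (· < ·) t l}),
          evalWord g u * x * evalWord g v ∈ Submodule.span K
            (evalWord g '' {t | t ∈ (List.range N).flatMap (normalWords L)}) := by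
        intro x hx
        induction hx using Submodule.span_induction with
        | mem x hx =>
          obtain ⟨t, ht, rfl⟩ := hx
          rw [← evalWord_append, ← evalWord_append]
          exact ih _ (shortlex_append_append (List.Shortlex.append_left ht _) _)
        | zero => simp
        | add x y _ _ hx hy => rw [mul_add, add_mul]; exact Submodule.add_mem _ hx hy
        | smul c x _ hx =>
          rw [mul_smul_comm, smul_mul_assoc]; exact Submodule.smul_mem _ _ hx
      rw [evalWord_append, evalWord_append]
      exact key _ (hL l hl)

/-- If all the words of `L` are reducible, an algebra generated by `g` is spanned by the words with
no factor in `L`. -/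
theorem finite_and_finrank_le (g : Fin m → A) (hg : Algebra.adjoin K (Set.range g) = ⊤)
    (L : List (List (Fin m))) (N : ℕ) (hN : normalWords L N = [])
    (hL : ∀ l ∈ L, Reducible K g l) :
    Module.Finite K A ∧
      Module.finrank K A ≤ ((List.range N).flatMap (normalWords L)).length := by
  set W := (List.range N).flatMap (normalWords L) with hW
  have hspan : Submodule.span K (evalWord g '' {t | t ∈ W}) = ⊤ := by
    rw [eq_top_iff, ← Algebra.top_toSubmodule, ← hg, Algebra.adjoin_eq_span, Submodule.span_le]
    intro x hx
    obtain ⟨ws, hws, rfl⟩ := Submonoid.exists_list_of_mem_closure hx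
    obtain ⟨w, rfl⟩ : ∃ w : List (Fin m), w.map g = ws := by
      rw [← Set.mem_range, Set.range_list_map]
      exact hws
    exact evalWord_mem_span g L N hN hL w
  have hrange : Set.range (fun i : Fin W.length => evalWord g (W.get i)) =
      evalWord g '' {t | t ∈ W} := by
    rw [← Set.range_list_get, ← Set.range_comp]
    rfl
  rw [← hrange] at hspan
  constructor
  · exact ⟨⟨(Set.finite_range _).toFinset, by simpa using hspan⟩⟩
  · have h := finrank_range_le_card (R := K) (fun i : Fin W.length => evalWord g (W.get i))
    rw [Set.finrank, hspan, finrank_top, Fintype.card_fin] at h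
    exact h

end Words

/-! ### Consequences of the defining relations on three and four strands -/

section Rewriting

variable {K A : Type*} [Field K] [Ring A] [Algebra K A] {t u v : K} {s₁ s₂ s₃ : A}

/-- In a fully right-associated product, a factor followed by more letters is not a subterm. The
lemmas `asc2` to `asc6` extend a rule by an arbitrary tail, so that `simp` can apply it inside a
word. -/
theorem asc2 {x y e : A} (h : x * y = e) (w : A) :
    x * (y * w) = e * w := by
  rw [← h]; simp only [mul_assoc]

theorem asc3 {x y z e : A} (h : x * (y * z) = e) (w : A) :
    x * (y * (z * w)) = e * w := by
  rw [← h]; simp only [mul_assoc]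

theorem asc4 {x y z p e : A} (h : x * (y * (z * p)) = e) (w : A) :
    x * (y * (z * (p * w))) = e * w := by
  rw [← h]; simp only [mul_assoc]

theorem asc5 {x y z p q e : A} (h : x * (y * (z * (p * q))) = e) (w : A) :
    x * (y * (z * (p * (q * w)))) = e * w := by
  rw [← h]; simp only [mul_assoc]

theorem asc6 {x y z p q r e : A} (h : x * (y * (z * (p * (q * r)))) = e) (w : A) :
    x * (y * (z * (p * (q * (r * w))))) = e * w := by
  rw [← h]; simp only [mul_assoc]

/-- The defining relations of the cubic Hecke algebra on three strands, as rewriting rules. -/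
structure CubicRules (t u v : K) (s₁ s₂ : A) : Prop where
  r111 : s₁ * (s₁ * s₁) = t • (s₁ * s₁) - u • s₁ + v • 1
  r222 : s₂ * (s₂ * s₂) = t • (s₂ * s₂) - u • s₂ + v • 1
  r212 : s₂ * (s₁ * s₂) = s₁ * (s₂ * s₁)

/-- The relations on three strands together with the vanishing of `𝐛`. -/
structure ThreeRules (t u v : K) (s₁ s₂ : A) : Prop extends CubicRules t u v s₁ s₂ where
  r221 : s₂ * (s₂ * s₁) = s₂ * (s₁ * s₁) + s₁ * (s₂ * s₂) - s₁ * (s₁ * s₂)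

/-- Rewriting rules on four strands. -/
structure FourRules (t u v : K) (s₁ s₂ s₃ : A) : Prop extends ThreeRules t u v s₁ s₂ where
  r31 : s₃ * s₁ = s₁ * s₃
  r333 : s₃ * (s₃ * s₃) = t • (s₃ * s₃) - u • s₃ + v • 1
  r232 : s₂ * (s₃ * s₂) = s₃ * (s₂ * s₃)
  r322 : s₃ * (s₂ * s₂) = s₃ * (s₃ * s₂) + s₁ * (s₂ * s₂) - s₁ * (s₃ * s₃) - s₁ * (s₁ * s₂) + s₁ *
      (s₁ * s₃)
  r223 : s₂ * (s₂ * s₃) = s₂ * (s₃ * s₃) + s₁ * (s₂ * s₂) - s₁ * (s₃ * s₃) - s₁ * (s₁ * s₂) + s₁ *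
      (s₁ * s₃)

/-- This rule and the `FourRules` ones below come from resolving an overlap: `e` equates two
bracketings of one word, each starting with a known rule, and comparing the reductions isolates a
new leading word, recorded in the name. Here the overlap is 2212, between 221 and 212. -/
theorem ThreeRules.r2112 (h : ThreeRules t u v s₁ s₂) : s₂ * (s₁ * (s₁ * s₂)) =
      s₁ * (s₂ * (s₁ * s₁)) + s₁ * (s₁ * (s₂ * s₂)) - t • (s₁ * (s₂ * s₂)) + u • (s₁ * s₂) - v •
      s₁ := by
  have e : (s₂ * (s₂ * s₁)) * s₂ = s₂ * (s₂ * (s₁ * s₂)) := by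
    simp only [mul_assoc]
  rw [h.r221, h.r212] at e
  simp only [mul_add, add_mul, mul_sub, sub_mul, mul_neg, neg_mul, neg_neg, smul_mul_assoc,
    mul_smul_comm, smul_add, smul_sub, smul_neg, mul_one, one_mul, mul_assoc, asc3 h.r111, asc3
    h.r212, asc3 h.r222, asc3 h.r221, h.r111, h.r212, h.r222, h.r221] at e
  linear_combination (norm := module) (1 : K) • e

theorem FourRules.r3211 (h : FourRules t u v s₁ s₂ s₃) : s₃ * (s₂ * (s₁ * s₁)) =
      s₃ * (s₃ * (s₂ * s₁)) + s₁ * (s₂ * (s₁ * s₁)) - s₁ * (s₃ * (s₃ * s₂)) - s₁ * (s₁ * (s₂ *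
      s₁)) + s₁ * (s₁ * (s₃ * s₂)) := by
  have e : (s₃ * (s₂ * s₂)) * s₁ = s₃ * (s₂ * (s₂ * s₁)) := by
    simp only [mul_assoc]
  rw [h.r322, h.r221] at e
  simp only [mul_add, add_mul, mul_sub, sub_mul, mul_neg, neg_mul, neg_neg, smul_mul_assoc,
    mul_smul_comm, smul_add, smul_sub, smul_neg, mul_one, one_mul, mul_assoc, asc3 h.r111, asc3
    h.r212, asc3 h.r222, asc3 h.r221, asc4 h.r2112, asc2 h.r31, asc3 h.r333, asc3 h.r232, asc3
    h.r322, asc3 h.r223, h.r111, h.r212, h.r222, h.r221, h.r2112, h.r31, h.r333, h.r232, h.r322,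
    h.r223] at e
  linear_combination (norm := module) (-1 : K) • e

theorem FourRules.r3233 (h : FourRules t u v s₁ s₂ s₃) : s₃ * (s₂ * (s₃ * s₃)) =
      s₃ * (s₃ * (s₂ * s₃)) + s₁ * (s₂ * (s₃ * s₃)) - s₁ * (s₃ * (s₃ * s₂)) - s₁ * (s₁ * (s₂ *
      s₃)) + s₁ * (s₁ * (s₃ * s₂)) := by
  have e : (s₃ * (s₂ * s₂)) * s₃ = s₃ * (s₂ * (s₂ * s₃)) := by
    simp only [mul_assoc]
  rw [h.r322, h.r223] at e
  simp only [mul_add, add_mul, mul_sub, sub_mul, mul_neg, neg_mul, neg_neg, smul_mul_assoc,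
    mul_smul_comm, smul_add, smul_sub, smul_neg, mul_one, one_mul, mul_assoc, asc3 h.r111, asc3
    h.r212, asc3 h.r222, asc3 h.r221, asc4 h.r2112, asc2 h.r31, asc3 h.r333, asc3 h.r232, asc3
    h.r322, asc3 h.r223, asc4 h.r3211, h.r111, h.r212, h.r222, h.r221, h.r2112, h.r31, h.r333,
    h.r232, h.r322, h.r223, h.r3211] at e
  linear_combination (norm := module) (-1 : K) • e

theorem FourRules.r2133 (h : FourRules t u v s₁ s₂ s₃) : s₂ * (s₁ * (s₃ * s₃)) =
      s₂ * (s₁ * (s₁ * s₃)) + s₁ * (s₂ * (s₃ * s₃)) - s₁ * (s₂ * (s₁ * s₁)) - s₁ * (s₁ * (s₂ *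
      s₃)) + s₁ * (s₁ * (s₂ * s₁)) := by
  have e : (s₂ * (s₂ * s₃)) * s₁ = (s₂ * s₂) * (s₃ * s₁) := by
    simp only [mul_assoc]
  rw [h.r223, h.r31] at e
  simp only [mul_add, add_mul, mul_sub, sub_mul, mul_neg, neg_mul, neg_neg, smul_mul_assoc,
    mul_smul_comm, smul_add, smul_sub, smul_neg, mul_one, one_mul, mul_assoc, asc3 h.r111, asc3
    h.r212, asc3 h.r222, asc3 h.r221, asc4 h.r2112, asc2 h.r31, asc3 h.r333, asc3 h.r232, asc3
    h.r322, asc3 h.r223, asc4 h.r3211, asc4 h.r3233, h.r111, h.r212, h.r222, h.r221, h.r2112,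
    h.r31, h.r333, h.r232, h.r322, h.r223, h.r3211, h.r3233] at e
  linear_combination (norm := module) (1 : K) • e

theorem FourRules.r2332 (h : FourRules t u v s₁ s₂ s₃) : s₂ * (s₃ * (s₃ * s₂)) =
      s₃ * (s₃ * (s₂ * s₃)) + s₁ * (s₂ * (s₃ * s₃)) + s₁ * (s₁ * (s₂ * s₂)) - s₁ * (s₁ * (s₂ *
      s₃)) - t • (s₁ * (s₂ * s₂)) + u • (s₁ * s₂) - v • s₁ := by
  have e : (s₂ * (s₃ * s₂)) * s₂ = s₂ * (s₃ * (s₂ * s₂)) := by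
    simp only [mul_assoc]
  rw [h.r232, h.r322] at e
  simp only [mul_add, add_mul, mul_sub, sub_mul, mul_neg, neg_mul, neg_neg, smul_mul_assoc,
    mul_smul_comm, smul_add, smul_sub, smul_neg, mul_one, one_mul, mul_assoc, asc3 h.r111, asc3
    h.r212, asc3 h.r222, asc3 h.r221, asc4 h.r2112, asc2 h.r31, asc3 h.r333, asc3 h.r232, asc3
    h.r322, asc3 h.r223, asc4 h.r3211, asc4 h.r3233, asc4 h.r2133, h.r111, h.r212, h.r222, h.r221,
    h.r2112, h.r31, h.r333, h.r232, h.r322, h.r223, h.r3211, h.r3233, h.r2133] at e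
  linear_combination (norm := module) (-1 : K) • e

theorem FourRules.r21323 (h : FourRules t u v s₁ s₂ s₃) : s₂ * (s₁ * (s₃ * (s₂ * s₃))) =
      s₁ * (s₂ * (s₁ * (s₃ * s₂))) := by
  have e : (s₂ * (s₁ * s₂)) * (s₃ * s₂) = (s₂ * s₁) * (s₂ * (s₃ * s₂)) := by
    simp only [mul_assoc]
  rw [h.r212, h.r232] at e
  simp only [mul_add, add_mul, mul_sub, sub_mul, mul_neg, neg_mul, neg_neg, smul_mul_assoc,
    mul_smul_comm, smul_add, smul_sub, smul_neg, mul_one, one_mul, mul_assoc, asc3 h.r111, asc3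
    h.r212, asc3 h.r222, asc3 h.r221, asc4 h.r2112, asc2 h.r31, asc3 h.r333, asc3 h.r232, asc3
    h.r322, asc3 h.r223, asc4 h.r3211, asc4 h.r3233, asc4 h.r2133, asc4 h.r2332, h.r111, h.r212,
    h.r222, h.r221, h.r2112, h.r31, h.r333, h.r232, h.r322, h.r223, h.r3211, h.r3233, h.r2133,
    h.r2332] at e
  linear_combination (norm := module) (-1 : K) • e

theorem FourRules.r21133 (h : FourRules t u v s₁ s₂ s₃) : s₂ * (s₁ * (s₁ * (s₃ * s₃))) =
      s₁ * (s₂ * (s₁ * (s₁ * s₃))) + s₁ * (s₁ * (s₂ * (s₃ * s₃))) - s₁ * (s₁ * (s₂ * (s₁ * s₃))) +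
      t • (s₂ * (s₁ * (s₁ * s₃))) - t • (s₁ * (s₂ * (s₁ * s₁))) - t • (s₁ * (s₁ * (s₂ * s₃))) + t
      • (s₁ * (s₁ * (s₂ * s₁))) - u • (s₂ * (s₁ * s₃)) + u • (s₁ * (s₂ * s₃)) + v • (s₂ * s₁) - v
      • (s₁ * s₂) := by
  have e : (s₂ * (s₁ * s₂)) * (s₂ * s₃) = (s₂ * s₁) * (s₂ * (s₂ * s₃)) := by
    simp only [mul_assoc]
  rw [h.r212, h.r223] at e
  simp only [mul_add, add_mul, mul_sub, sub_mul, mul_neg, neg_mul, neg_neg, smul_mul_assoc,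
    mul_smul_comm, smul_add, smul_sub, smul_neg, mul_one, one_mul, mul_assoc, asc3 h.r111, asc3
    h.r212, asc3 h.r222, asc3 h.r221, asc4 h.r2112, asc2 h.r31, asc3 h.r333, asc3 h.r232, asc3
    h.r322, asc3 h.r223, asc4 h.r3211, asc4 h.r3233, asc4 h.r2133, asc4 h.r2332, asc5 h.r21323,
    h.r111, h.r212, h.r222, h.r221, h.r2112, h.r31, h.r333, h.r232, h.r322, h.r223, h.r3211,
    h.r3233, h.r2133, h.r2332, h.r21323] at e
  linear_combination (norm := module) (1 : K) • e

theorem FourRules.r21321 (h : FourRules t u v s₁ s₂ s₃) : s₂ * (s₁ * (s₃ * (s₂ * s₁))) =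
      s₃ * (s₂ * (s₁ * (s₃ * s₂))) := by
  have e : (s₂ * (s₃ * s₂)) * (s₁ * s₂) = (s₂ * s₃) * (s₂ * (s₁ * s₂)) := by
    simp only [mul_assoc]
  rw [h.r232, h.r212] at e
  simp only [mul_add, add_mul, mul_sub, sub_mul, mul_neg, neg_mul, neg_neg, smul_mul_assoc,
    mul_smul_comm, smul_add, smul_sub, smul_neg, mul_one, one_mul, mul_assoc, asc3 h.r111, asc3
    h.r212, asc3 h.r222, asc3 h.r221, asc4 h.r2112, asc2 h.r31, asc3 h.r333, asc3 h.r232, asc3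
    h.r322, asc3 h.r223, asc4 h.r3211, asc4 h.r3233, asc4 h.r2133, asc4 h.r2332, asc5 h.r21323,
    asc5 h.r21133, h.r111, h.r212, h.r222, h.r221, h.r2112, h.r31, h.r333, h.r232, h.r322, h.r223,
    h.r3211, h.r3233, h.r2133, h.r2332, h.r21323, h.r21133] at e
  linear_combination (norm := module) (-1 : K) • e

theorem FourRules.r211323 (h : FourRules t u v s₁ s₂ s₃) : s₂ * (s₁ * (s₁ * (s₃ * (s₂ * s₃)))) =
      s₁ * (s₂ * (s₁ * (s₁ * (s₃ * s₂)))) + s₁ * (s₁ * (s₃ * (s₃ * (s₂ * s₃)))) - t • (s₁ * (s₃ *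
      (s₃ * (s₂ * s₃)))) - u • (s₁ * (s₂ * (s₃ * s₃))) + u • (s₁ * (s₃ * (s₂ * s₃))) + u • (s₁ *
      (s₃ * (s₃ * s₂))) + u • (s₁ * (s₁ * (s₂ * s₃))) - u • (s₁ * (s₁ * (s₃ * s₂))) + v • (s₂ *
      (s₃ * s₃)) - v • (s₃ * (s₃ * s₂)) - v • (s₁ * (s₂ * s₃)) := by
  have e : (s₂ * (s₁ * s₂)) * (s₃ * (s₃ * s₂)) = (s₂ * s₁) * (s₂ * (s₃ * (s₃ * s₂))) := by
    simp only [mul_assoc]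
  rw [h.r212, h.r2332] at e
  simp only [mul_add, add_mul, mul_sub, sub_mul, mul_neg, neg_mul, neg_neg, smul_mul_assoc,
    mul_smul_comm, smul_add, smul_sub, smul_neg, mul_one, one_mul, mul_assoc, asc3 h.r111, asc3
    h.r212, asc3 h.r222, asc3 h.r221, asc4 h.r2112, asc2 h.r31, asc3 h.r333, asc3 h.r232, asc3
    h.r322, asc3 h.r223, asc4 h.r3211, asc4 h.r3233, asc4 h.r2133, asc4 h.r2332, asc5 h.r21323,
    asc5 h.r21133, asc5 h.r21321, h.r111, h.r212, h.r222, h.r221, h.r2112, h.r31, h.r333, h.r232,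
    h.r322, h.r223, h.r3211, h.r3233, h.r2133, h.r2332, h.r21323, h.r21133, h.r21321] at e
  linear_combination (norm := module) (-1 : K) • e

theorem FourRules.r211321 (h : FourRules t u v s₁ s₂ s₃) : s₂ * (s₁ * (s₁ * (s₃ * (s₂ * s₁)))) =
      s₃ * (s₃ * (s₂ * (s₁ * (s₃ * s₂)))) + s₁ * (s₂ * (s₁ * (s₁ * (s₃ * s₂)))) - s₁ * (s₃ * (s₃ *
      (s₂ * (s₁ * s₃)))) - s₁ * (s₁ * (s₂ * (s₁ * (s₃ * s₂)))) - s₁ * (s₁ * (s₂ * (s₁ * (s₁ *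
      s₃)))) + s₁ * (s₁ * (s₃ * (s₂ * (s₁ * s₃)))) + s₁ * (s₁ * (s₃ * (s₃ * (s₂ * s₃)))) + t • (s₁
      * (s₁ * (s₂ * (s₁ * s₃)))) - t • (s₁ * (s₁ * (s₃ * (s₂ * s₃)))) - u • (s₁ * (s₂ * (s₁ *
      s₃))) + u • (s₁ * (s₃ * (s₂ * s₃))) + v • (s₂ * (s₁ * s₃)) - v • (s₃ * (s₂ * s₃)) := by
  have e : (s₂ * (s₂ * s₁)) * (s₃ * (s₂ * s₁)) = s₂ * (s₂ * (s₁ * (s₃ * (s₂ * s₁)))) := by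
    simp only [mul_assoc]
  rw [h.r221, h.r21321] at e
  simp only [mul_add, add_mul, mul_sub, sub_mul, mul_neg, neg_mul, neg_neg, smul_mul_assoc,
    mul_smul_comm, smul_add, smul_sub, smul_neg, mul_one, one_mul, mul_assoc, asc3 h.r111, asc3
    h.r212, asc3 h.r222, asc3 h.r221, asc4 h.r2112, asc2 h.r31, asc3 h.r333, asc3 h.r232, asc3
    h.r322, asc3 h.r223, asc4 h.r3211, asc4 h.r3233, asc4 h.r2133, asc4 h.r2332, asc5 h.r21323,
    asc5 h.r21133, asc5 h.r21321, asc6 h.r211323, h.r111, h.r212, h.r222, h.r221, h.r2112, h.r31,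
    h.r333, h.r232, h.r322, h.r223, h.r3211, h.r3233, h.r2133, h.r2332, h.r21323, h.r21133,
    h.r21321, h.r211323] at e
  linear_combination (norm := module) (1 : K) • e

theorem CubicRules.r21121 (h : CubicRules t u v s₁ s₂) :
    s₂ * (s₁ * (s₁ * (s₂ * s₁))) = s₁ * (s₂ * (s₁ * (s₁ * s₂))) := by
  have e : (s₂ * (s₁ * s₂)) * (s₁ * s₂) = (s₂ * s₁) * (s₂ * (s₁ * s₂)) := by
    simp only [mul_assoc]
  rw [h.r212] at e
  simp only [mul_assoc] at e
  exact e.symm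

/-- The overlap 211212 reduces to the desired relation multiplied on the left by s₁, so
invertibility of s₁ is used to cancel it. -/
theorem CubicRules.r21122 (h : CubicRules t u v s₁ s₂) (hs : IsUnit s₁) :
    s₂ * (s₁ * (s₁ * (s₂ * s₂))) = s₁ * (s₁ * (s₂ * (s₂ * s₁))) + t • (s₂ * (s₁ * (s₁ * s₂))) -
      t • (s₁ * (s₂ * (s₂ * s₁))) + u • (s₂ * (s₂ * s₁)) - u • (s₂ * (s₁ * s₁)) := by
  refine hs.mul_left_cancel ?_
  have e : (s₂ * (s₁ * (s₁ * (s₂ * s₁)))) * s₂ = (s₂ * (s₁ * s₁)) * (s₂ * (s₁ * s₂)) := by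
    simp only [mul_assoc]
  rw [h.r21121, h.r212] at e
  simp only [mul_add, add_mul, mul_sub, sub_mul, mul_neg, neg_mul, neg_neg, smul_mul_assoc,
    mul_smul_comm, smul_add, smul_sub, smul_neg, mul_one, one_mul, mul_assoc, asc3 h.r111,
    asc3 h.r212, asc3 h.r222, asc5 h.r21121, h.r111, h.r212, h.r222, h.r21121] at e ⊢
  linear_combination (norm := module) (1 : K) • e

/-- The word 2112212 is multiplied on the left by s₁ so that a cube of s₁ appears; its constant term
releases `v` times the leading word 22112, whence the division by `v`. -/
theorem CubicRules.r22112 (h : CubicRules t u v s₁ s₂) (hs : IsUnit s₁) (hv : v ≠ 0) :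
    s₂ * (s₂ * (s₁ * (s₁ * s₂))) = s₁ * (s₂ * (s₂ * (s₁ * s₁))) + t • (s₂ * (s₁ * (s₁ * s₂))) -
      t • (s₁ * (s₂ * (s₂ * s₁))) + u • (s₁ * (s₂ * s₂)) - u • (s₁ * (s₁ * s₂)) := by
  refine smul_right_injective A hv ?_
  have e : s₁ * (s₂ * (s₁ * (s₁ * (s₂ * s₂))) * (s₁ * s₂)) =
      s₁ * ((s₂ * (s₁ * (s₁ * s₂))) * (s₂ * (s₁ * s₂))) := by
    simp only [mul_assoc]
  rw [h.r21122 hs, h.r212] at e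
  simp only [mul_add, add_mul, mul_sub, sub_mul, mul_neg, neg_mul, neg_neg, smul_mul_assoc,
    mul_smul_comm, smul_add, smul_sub, smul_neg, mul_one, one_mul, mul_assoc, asc3 h.r111,
    asc3 h.r212, asc3 h.r222, asc5 h.r21121, asc5 (h.r21122 hs), h.r111, h.r212, h.r222, h.r21121,
    h.r21122 hs] at e ⊢
  linear_combination (norm := module) (1 : K) • e

/-- The vanishing of `𝐛` is transported from `s₁, s₂` to `s₂, s₃` by conjugation. -/
theorem bElement_shift (h₁ : IsUnit s₁) (h₂ : IsUnit s₂) (h₃ : IsUnit s₃)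
    (h12 : s₁ * s₂ * s₁ = s₂ * s₁ * s₂) (h23 : s₂ * s₃ * s₂ = s₃ * s₂ * s₃)
    (h13 : s₁ * s₃ = s₃ * s₁) (hb : bElement s₁ s₂ = 0) : bElement s₂ s₃ = 0 := by
  have c1 : s₁ * s₂ * s₃ * s₁ = s₂ * (s₁ * s₂ * s₃) := by
    rw [mul_assoc, ← h13, ← mul_assoc, h12]; simp only [mul_assoc]
  have c2 : s₁ * s₂ * s₃ * s₂ = s₃ * (s₁ * s₂ * s₃) := by
    rw [mul_assoc s₁, mul_assoc s₁, h23, ← mul_assoc, ← mul_assoc, h13]; simp only [mul_assoc]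
  have i1 : ∀ z, s₁ * s₂ * s₃ * (s₁ * z) = s₂ * (s₁ * s₂ * s₃ * z) := by
    intro z; rw [← mul_assoc, c1, mul_assoc]
  have i2 : ∀ z, s₁ * s₂ * s₃ * (s₂ * z) = s₃ * (s₁ * s₂ * s₃ * z) := by
    intro z; rw [← mul_assoc, c2, mul_assoc]
  have key : s₁ * s₂ * s₃ * bElement s₁ s₂ = bElement s₂ s₃ * (s₁ * s₂ * s₃) := by
    generalize s₁ * s₂ * s₃ = x at *
    simp only [bElement, Ring.lie_def, mul_sub, sub_mul, pow_two, mul_assoc, i1, i2, c1, c2]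
  rw [hb, mul_zero] at key
  exact ((h₁.mul h₂).mul h₃).mul_left_eq_zero.1 key.symm

theorem bElement_eq : bElement s₁ s₂ = s₂ * (s₂ * s₁) - s₁ * (s₂ * s₂) - s₂ * (s₁ * s₁) +
    s₁ * (s₁ * s₂) := by
  simp only [bElement, Ring.lie_def, pow_two, mul_assoc]
  abel

theorem four_strand_relation (h₁ : IsUnit s₁) (h₂ : IsUnit s₂) (h₃ : IsUnit s₃)
    (h12 : s₁ * s₂ * s₁ = s₂ * s₁ * s₂) (h23 : s₂ * s₃ * s₂ = s₃ * s₂ * s₃)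
    (h13 : s₁ * s₃ = s₃ * s₁) (hb : bElement s₁ s₂ = 0) :
    s₂ * (s₃ * s₃) - s₂ * (s₂ * s₃) - s₁ * (s₃ * s₃) + s₁ * (s₂ * s₂) + s₁ * (s₁ * s₃) -
      s₁ * (s₁ * s₂) = 0 := by
  have hb' := bElement_shift h₁ h₂ h₃ h12 h23 h13 hb
  have r31 := h13.symm
  have r212 : s₂ * (s₁ * s₂) = s₁ * (s₂ * s₁) := by rw [← mul_assoc, ← h12, mul_assoc]
  have r323 : s₃ * (s₂ * s₃) = s₂ * (s₃ * s₂) := by rw [← mul_assoc, ← h23, mul_assoc]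
  have r3213 : s₃ * (s₂ * (s₁ * s₃)) = s₂ * (s₃ * (s₂ * s₁)) := by
    rw [h13, ← mul_assoc s₂, ← mul_assoc, r323]; simp only [mul_assoc]
  have r21121 : s₂ * (s₁ * (s₁ * (s₂ * s₁))) = s₁ * (s₂ * (s₁ * (s₁ * s₂))) := by
    rw [← r212, ← mul_assoc s₁, ← mul_assoc s₂, r212]; simp only [mul_assoc]
  have r32113 : s₃ * (s₂ * (s₁ * (s₁ * s₃))) = s₂ * (s₃ * (s₂ * (s₁ * s₁))) := by
    rw [h13, ← mul_assoc s₁, h13, mul_assoc, ← mul_assoc s₂, ← mul_assoc, r323]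
    simp only [mul_assoc]
  have r32232 : s₃ * (s₂ * (s₂ * (s₃ * s₂))) = s₂ * (s₃ * (s₂ * (s₂ * s₃))) := by
    rw [← r323, ← mul_assoc s₂, ← mul_assoc s₃, r323]; simp only [mul_assoc]
  -- An explicit membership certificate: up to unit factors on both sides, the relation lies in the
  -- ideal generated by the two 𝐛 elements. The rules above use the braid relations only, not the
  -- cubic ones.
  have key : s₁ * ((s₂ * (s₃ * s₃) - s₂ * (s₂ * s₃) - s₁ * (s₃ * s₃) + s₁ * (s₂ * s₂) +
      s₁ * (s₁ * s₃) - s₁ * (s₁ * s₂)) * (s₂ * s₃)) =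
      -(s₂ * (bElement s₂ s₃ * (s₁ * s₂))) + s₂ * (bElement s₁ s₂ * (s₃ * s₂)) +
      bElement s₁ s₂ * (s₁ * (s₃ * s₂)) + s₂ * (s₁ * (bElement s₂ s₃ * s₁)) +
      s₂ * (s₁ * (s₃ * bElement s₁ s₂)) - bElement s₁ s₂ * (s₃ * (s₂ * s₂)) -
      s₂ * (s₂ * (s₁ * bElement s₂ s₃)) + bElement s₁ s₂ * (s₂ * (s₃ * s₂)) +
      s₁ * (bElement s₁ s₂ * (s₃ * s₂)) - s₁ * (bElement s₁ s₂ * (s₂ * s₃)) := by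
    simp only [bElement_eq, mul_add, add_mul, mul_sub, sub_mul, mul_assoc, asc2 r31, asc3 r212,
      asc3 r323, asc4 r3213, asc5 r21121, asc5 r32113, asc5 r32232, r31, r212, r323, r3213, r21121,
      r32113, r32232]
    abel
  simp only [hb, hb', zero_mul, mul_zero, neg_zero, add_zero, sub_zero] at key
  exact (h₂.mul h₃).mul_left_eq_zero.1 (h₁.mul_right_eq_zero.1 key)

theorem cubic_expand {a b c : K} {s : A} (h : (s - algebraMap K A a) * (s - algebraMap K A b) *
    (s - algebraMap K A c) = 0) :
    s * (s * s) = (a + b + c) • (s * s) - (a * b + b * c + a * c) • s + (a * b * c) • 1 := by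
  simp only [Algebra.algebraMap_eq_smul_one, mul_sub, sub_mul, smul_mul_assoc, mul_smul_comm,
    mul_one, one_mul, smul_sub, mul_assoc] at h
  linear_combination (norm := module) (1 : K) • h

theorem cubicRules_of {a b c : K} (hc₁ : (s₁ - algebraMap K A a) * (s₁ - algebraMap K A b) *
    (s₁ - algebraMap K A c) = 0) (hc₂ : (s₂ - algebraMap K A a) * (s₂ - algebraMap K A b) *
    (s₂ - algebraMap K A c) = 0) (h12 : s₁ * s₂ * s₁ = s₂ * s₁ * s₂) :
    CubicRules (a + b + c) (a * b + b * c + a * c) (a * b * c) s₁ s₂ where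
  r111 := cubic_expand hc₁
  r222 := cubic_expand hc₂
  r212 := by rw [← mul_assoc, ← h12, mul_assoc]

theorem threeRules_of (h : CubicRules t u v s₁ s₂) (hb : bElement s₁ s₂ = 0) :
    ThreeRules t u v s₁ s₂ where
  toCubicRules := h
  r221 := by
    rw [bElement_eq] at hb
    linear_combination (norm := module) (1 : K) • hb

theorem fourRules_of (h : ThreeRules t u v s₁ s₂) (hc : CubicRules t u v s₂ s₃)
    (h₁ : IsUnit s₁) (h₂ : IsUnit s₂) (h₃ : IsUnit s₃)
    (h12 : s₁ * s₂ * s₁ = s₂ * s₁ * s₂) (h23 : s₂ * s₃ * s₂ = s₃ * s₂ * s₃)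
    (h13 : s₁ * s₃ = s₃ * s₁) (hb : bElement s₁ s₂ = 0) : FourRules t u v s₁ s₂ s₃ := by
  have hb' := bElement_shift h₁ h₂ h₃ h12 h23 h13 hb
  have hr := four_strand_relation h₁ h₂ h₃ h12 h23 h13 hb
  rw [bElement_eq] at hb'
  exact
  { toThreeRules := h
    r31 := h13.symm
    r333 := hc.r222
    r232 := hc.r212.symm
    r322 := by linear_combination (norm := module) (-1 : K) • hr - (1 : K) • hb'
    r223 := by linear_combination (norm := module) (-1 : K) • hr }

end Rewriting

/-! ### Artin generators in the group algebra and its quotients. -/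

section Generators

variable {K : Type*} [Field K]

theorem gen_braid (n : ℕ) (i j : Fin (n - 1)) (h : (i : ℕ) + 1 = j) :
    gen K n i * gen K n j * gen K n i = gen K n j * gen K n i * gen K n j := by
  simp only [gen, ← map_mul]
  congr 1
  exact PresentedGroup.mk_eq_mk_of_mul_inv_mem (rels := {w | BraidRelation n w})
    (BraidRelation.braid i j h)

theorem gen_comm (n : ℕ) (i j : Fin (n - 1)) (h : (i : ℕ) + 1 < j) :
    gen K n i * gen K n j = gen K n j * gen K n i := by
  simp only [gen, ← map_mul]
  congr 1
  exact PresentedGroup.mk_eq_mk_of_mul_inv_mem (rels := {w | BraidRelation n w})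
    (BraidRelation.comm i j h)

theorem isUnit_gen (n : ℕ) (i : Fin (n - 1)) : IsUnit (gen K n i) :=
  (Group.isUnit (PresentedGroup.of i : BraidGroup n)).map (MonoidAlgebra.of K (BraidGroup n))

theorem ringCon_mk_surjective {A : Type*} [Ring A] [Algebra K A] (I : TwoSidedIdeal A) :
    Function.Surjective (I.ringCon.mkₐ K) :=
  Quotient.mk_surjective

theorem cubicMk_surjective (n : ℕ) (a b c : Kˣ) : Function.Surjective (cubicMk n a b c) :=
  ringCon_mk_surjective _

theorem tripledMk_surjective (n : ℕ) (a b c : Kˣ) : Function.Surjective (tripledMk n a b c) :=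
  ringCon_mk_surjective _

theorem kMk_surjective (n : ℕ) (a b c : Kˣ) : Function.Surjective (kMk n a b c) :=
  ringCon_mk_surjective _

theorem cubicToTripled_surjective (n : ℕ) (a b c : Kˣ) :
    Function.Surjective (cubicToTripled n a b c) := fun y => by
  obtain ⟨x, rfl⟩ := tripledMk_surjective n a b c y
  exact ⟨cubicMk n a b c x, rfl⟩

theorem toTripled_surjective (n : ℕ) (a b c : Kˣ) :
    Function.Surjective (toTripled n a b c) := fun y => by
  obtain ⟨x, rfl⟩ := cubicToTripled_surjective n a b c y
  exact ⟨kMk n a b c x, rfl⟩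

theorem cubicGen_cubic (n : ℕ) (a b c : Kˣ) (i : Fin (n - 1)) :
    (cubicGen n a b c i - algebraMap K _ (a : K)) * (cubicGen n a b c i - algebraMap K _ (b : K)) *
      (cubicGen n a b c i - algebraMap K _ (c : K)) = 0 := by
  have h : cubicMk n a b c ((gen K n i - algebraMap K _ (a : K)) *
      (gen K n i - algebraMap K _ (b : K)) * (gen K n i - algebraMap K _ (c : K))) = 0 :=
    (mk_eq_zero_iff _ _).2 (TwoSidedIdeal.subset_span ⟨i, rfl⟩)
  simp only [map_mul, map_sub, AlgHom.commutes] at h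
  exact h

/-- A quotient of the group algebra in which the generators satisfy a cubic relation is generated,
as an algebra, by the images of the Artin generators. -/
theorem adjoin_eq_top {A : Type*} [Ring A] [Algebra K A] (n : ℕ) (π : BraidAlgebra K n →ₐ[K] A)
    (hπ : Function.Surjective π) (a b c : Kˣ)
    (hc : ∀ i, (π (gen K n i) - algebraMap K _ (a : K)) * (π (gen K n i) - algebraMap K _ (b : K)) *
      (π (gen K n i) - algebraMap K _ (c : K)) = 0) :
    Algebra.adjoin K (Set.range fun i => π (gen K n i)) = ⊤ := by
  set S := Algebra.adjoin K (Set.range fun i => π (gen K n i)) with hS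
  have hgen : ∀ i, π (gen K n i) ∈ S := fun i => Algebra.subset_adjoin ⟨i, rfl⟩
  have hinv : ∀ i, π (MonoidAlgebra.of K (BraidGroup n) (PresentedGroup.of i)⁻¹) ∈ S := by
    intro i
    set y := π (MonoidAlgebra.of K (BraidGroup n) (PresentedGroup.of i)⁻¹)
    set s := π (gen K n i) with hs
    have hsy : s * y = 1 := by
      rw [hs, gen, ← map_mul, ← map_mul, mul_inv_cancel, map_one, map_one]
    -- Multiplying the cubic relation by the inverse `y` of `s` writes abc times `y` as a polynomial
    -- in `s`; as abc is invertible, inverses of generators add nothing to the subalgebra.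
    have h := congrArg (· * y) (cubic_expand (hc i))
    simp only [← hs, add_mul, sub_mul, smul_mul_assoc, mul_assoc, hsy, one_mul, mul_one] at h
    set v := (a * b * c : K) with hv'
    have hv : v ≠ 0 := (a * b * c).ne_zero
    have hy : y = v⁻¹ • (s * s - (a + b + c : K) • s + (a * b + b * c + a * c : K) • 1) := by
      rw [h, eq_inv_smul_iff₀ hv]
      module
    rw [hy]
    exact S.smul_mem (S.add_mem (S.sub_mem (S.mul_mem (hgen i) (hgen i)) (S.smul_mem (hgen i) _))
      (S.smul_mem S.one_mem _)) _
  have hgrp : ∀ x : BraidGroup n, π (MonoidAlgebra.of K (BraidGroup n) x) ∈ S ∧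
      π (MonoidAlgebra.of K (BraidGroup n) x⁻¹) ∈ S := by
    intro x
    have hx : x ∈ Subgroup.closure (Set.range (PresentedGroup.of (rels := {w | BraidRelation n w})))
        := by
      rw [PresentedGroup.closure_range_of]; trivial
    induction hx using Subgroup.closure_induction with
    | mem x hx =>
      obtain ⟨i, rfl⟩ := hx
      exact ⟨hgen i, hinv i⟩
    | one => rw [inv_one, map_one, map_one]; exact ⟨S.one_mem, S.one_mem⟩
    | mul x y _ _ hx hy =>
      rw [mul_inv_rev]
      simp only [map_mul]
      exact ⟨S.mul_mem hx.1 hy.1, S.mul_mem hy.2 hx.2⟩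
    | inv x _ hx => rw [inv_inv]; exact hx.symm
  rw [eq_top_iff]
  rintro y -
  obtain ⟨x, rfl⟩ := hπ y
  induction x using MonoidAlgebra.induction_on with
  | of x => exact (hgrp x).1
  | add x y hx hy => rw [map_add]; exact S.add_mem hx hy
  | smul r x hx => rw [map_smul]; exact S.smul_mem hx _

end Generators

/-! ### Dimension bounds by counting normal words. -/

section Dimensions

variable {K A : Type*} [Field K] [Ring A] [Algebra K A] {t u v : K} {s₁ s₂ s₃ : A}

/-- The words avoiding the six listed factors have length at most 6, and there are 24 of them; each
listed word is reducible by one of the rules above. -/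
theorem CubicRules.finite_finrank_le (h : CubicRules t u v s₁ s₂) (hs : IsUnit s₁) (hv : v ≠ 0)
    (hg : Algebra.adjoin K (Set.range ![s₁, s₂]) = ⊤) :
    Module.Finite K A ∧ Module.finrank K A ≤ 24 := by
  refine CubicHecke.finite_and_finrank_le ![s₁, s₂] hg
   [[0, 0, 0], [1, 1, 1], [1, 0, 1], [1, 0, 0, 1, 0], [1, 0, 0, 1, 1], [1, 1, 0, 0, 1]]
    7 (by decide +kernel) ?_
  simp only [List.forall_mem_cons]
  refine ⟨?_, ?_, ?_, ?_, ?_, ?_, by simp⟩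
  · refine reducible_of_eq_sum _ _ [t, -u, v]
      [[0, 0], [0], []] (by decide) ?_
    simp only [evalWord, List.map, List.prod_cons, List.prod_nil, List.zipWith, List.sum_cons,
      List.sum_nil, mul_one, Matrix.cons_val_zero, Matrix.cons_val_one]
    linear_combination (norm := module) (1 : K) • h.r111
  · refine reducible_of_eq_sum _ _ [t, -u, v]
      [[1, 1], [1], []] (by decide) ?_
    simp only [evalWord, List.map, List.prod_cons, List.prod_nil, List.zipWith, List.sum_cons,
      List.sum_nil, mul_one, Matrix.cons_val_zero, Matrix.cons_val_one]
    linear_combination (norm := module) (1 : K) • h.r222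
  · refine reducible_of_eq_sum _ _ [1]
      [[0, 1, 0]] (by decide) ?_
    simp only [evalWord, List.map, List.prod_cons, List.prod_nil, List.zipWith, List.sum_cons,
      List.sum_nil, mul_one, Matrix.cons_val_zero, Matrix.cons_val_one]
    linear_combination (norm := module) (1 : K) • h.r212
  · refine reducible_of_eq_sum _ _ [1]
      [[0, 1, 0, 0, 1]] (by decide) ?_
    simp only [evalWord, List.map, List.prod_cons, List.prod_nil, List.zipWith, List.sum_cons,
      List.sum_nil, mul_one, Matrix.cons_val_zero, Matrix.cons_val_one]
    linear_combination (norm := module) (1 : K) • h.r21121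
  · refine reducible_of_eq_sum _ _ [1, t, -t, u, -u]
      [[0, 0, 1, 1, 0], [1, 0, 0, 1], [0, 1, 1, 0], [1, 1, 0], [1, 0, 0]] (by decide) ?_
    simp only [evalWord, List.map, List.prod_cons, List.prod_nil, List.zipWith, List.sum_cons,
      List.sum_nil, mul_one, Matrix.cons_val_zero, Matrix.cons_val_one]
    linear_combination (norm := module) (1 : K) • h.r21122 hs
  · refine reducible_of_eq_sum _ _ [1, t, -t, u, -u]
      [[0, 1, 1, 0, 0], [1, 0, 0, 1], [0, 1, 1, 0], [0, 1, 1], [0, 0, 1]] (by decide) ?_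
    simp only [evalWord, List.map, List.prod_cons, List.prod_nil, List.zipWith, List.sum_cons,
      List.sum_nil, mul_one, Matrix.cons_val_zero, Matrix.cons_val_one]
    linear_combination (norm := module) (1 : K) • h.r22112 hs hv

theorem ThreeRules.finite_finrank_le (h : ThreeRules t u v s₁ s₂)
    (hg : Algebra.adjoin K (Set.range ![s₁, s₂]) = ⊤) :
    Module.Finite K A ∧ Module.finrank K A ≤ 15 := by
  refine CubicHecke.finite_and_finrank_le ![s₁, s₂] hg
   [[0, 0, 0], [1, 1, 1], [1, 0, 1], [1, 1, 0], [1, 0, 0, 1]]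
    6 (by decide +kernel) ?_
  simp only [List.forall_mem_cons]
  refine ⟨?_, ?_, ?_, ?_, ?_, by simp⟩
  · refine reducible_of_eq_sum _ _ [t, -u, v]
      [[0, 0], [0], []] (by decide) ?_
    simp only [evalWord, List.map, List.prod_cons, List.prod_nil, List.zipWith, List.sum_cons,
      List.sum_nil, mul_one, Matrix.cons_val_zero, Matrix.cons_val_one]
    linear_combination (norm := module) (1 : K) • h.r111
  · refine reducible_of_eq_sum _ _ [t, -u, v]
      [[1, 1], [1], []] (by decide) ?_
    simp only [evalWord, List.map, List.prod_cons, List.prod_nil, List.zipWith, List.sum_cons,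
      List.sum_nil, mul_one, Matrix.cons_val_zero, Matrix.cons_val_one]
    linear_combination (norm := module) (1 : K) • h.r222
  · refine reducible_of_eq_sum _ _ [1]
      [[0, 1, 0]] (by decide) ?_
    simp only [evalWord, List.map, List.prod_cons, List.prod_nil, List.zipWith, List.sum_cons,
      List.sum_nil, mul_one, Matrix.cons_val_zero, Matrix.cons_val_one]
    linear_combination (norm := module) (1 : K) • h.r212
  · refine reducible_of_eq_sum _ _ [1, 1, -1]
      [[1, 0, 0], [0, 1, 1], [0, 0, 1]] (by decide) ?_
    simp only [evalWord, List.map, List.prod_cons, List.prod_nil, List.zipWith, List.sum_cons,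
      List.sum_nil, mul_one, Matrix.cons_val_zero, Matrix.cons_val_one]
    linear_combination (norm := module) (1 : K) • h.r221
  · refine reducible_of_eq_sum _ _ [1, 1, -t, u, -v]
      [[0, 1, 0, 0], [0, 0, 1, 1], [0, 1, 1], [0, 1], [0]] (by decide) ?_
    simp only [evalWord, List.map, List.prod_cons, List.prod_nil, List.zipWith, List.sum_cons,
      List.sum_nil, mul_one, Matrix.cons_val_zero, Matrix.cons_val_one]
    linear_combination (norm := module) (1 : K) • h.r2112

/-- The letters are ordered s₁ < s₃ < s₂, so 0, 1, 2 stand for s₁, s₃, s₂. With this order every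
rule rewrites its leading word into smaller ones, for instance 232 into 323. -/
theorem FourRules.finite_finrank_le (h : FourRules t u v s₁ s₂ s₃)
    (hg : Algebra.adjoin K (Set.range ![s₁, s₃, s₂]) = ⊤) :
    Module.Finite K A ∧ Module.finrank K A ≤ 69 := by
  refine CubicHecke.finite_and_finrank_le ![s₁, s₃, s₂] hg
   [[0, 0, 0], [2, 0, 2], [2, 2, 2], [2, 2, 0], [2, 0, 0, 2], [1, 0], [1, 1, 1], [2, 1, 2], [1, 2,
      2], [2, 2, 1], [1, 2, 0, 0], [1, 2, 1, 1], [2, 0, 1, 1], [2, 1, 1, 2], [2, 0, 1, 2, 1], [2,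
      0, 0, 1, 1], [2, 0, 1, 2, 0], [2, 0, 0, 1, 2, 1], [2, 0, 0, 1, 2, 0]]
    10 (by decide +kernel) ?_
  simp only [List.forall_mem_cons]
  refine ⟨?_, ?_, ?_, ?_, ?_, ?_, ?_, ?_, ?_, ?_, ?_, ?_, ?_, ?_, ?_, ?_, ?_, ?_, ?_, by simp⟩
  · refine reducible_of_eq_sum _ _ [t, -u, v]
      [[0, 0], [0], []] (by decide) ?_
    simp only [evalWord, List.map, List.prod_cons, List.prod_nil, List.zipWith, List.sum_cons,
      List.sum_nil, mul_one, Matrix.cons_val_zero, Matrix.cons_val_one, Matrix.cons_val]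
    linear_combination (norm := module) (1 : K) • h.r111
  · refine reducible_of_eq_sum _ _ [1]
      [[0, 2, 0]] (by decide) ?_
    simp only [evalWord, List.map, List.prod_cons, List.prod_nil, List.zipWith, List.sum_cons,
      List.sum_nil, mul_one, Matrix.cons_val_zero, Matrix.cons_val_one, Matrix.cons_val]
    linear_combination (norm := module) (1 : K) • h.r212
  · refine reducible_of_eq_sum _ _ [t, -u, v]
      [[2, 2], [2], []] (by decide) ?_
    simp only [evalWord, List.map, List.prod_cons, List.prod_nil, List.zipWith, List.sum_cons,
      List.sum_nil, mul_one, Matrix.cons_val_zero, Matrix.cons_val_one, Matrix.cons_val]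
    linear_combination (norm := module) (1 : K) • h.r222
  · refine reducible_of_eq_sum _ _ [1, 1, -1]
      [[2, 0, 0], [0, 2, 2], [0, 0, 2]] (by decide) ?_
    simp only [evalWord, List.map, List.prod_cons, List.prod_nil, List.zipWith, List.sum_cons,
      List.sum_nil, mul_one, Matrix.cons_val_zero, Matrix.cons_val_one, Matrix.cons_val]
    linear_combination (norm := module) (1 : K) • h.r221
  · refine reducible_of_eq_sum _ _ [1, 1, -t, u, -v]
      [[0, 2, 0, 0], [0, 0, 2, 2], [0, 2, 2], [0, 2], [0]] (by decide) ?_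
    simp only [evalWord, List.map, List.prod_cons, List.prod_nil, List.zipWith, List.sum_cons,
      List.sum_nil, mul_one, Matrix.cons_val_zero, Matrix.cons_val_one, Matrix.cons_val]
    linear_combination (norm := module) (1 : K) • h.r2112
  · refine reducible_of_eq_sum _ _ [1]
      [[0, 1]] (by decide) ?_
    simp only [evalWord, List.map, List.prod_cons, List.prod_nil, List.zipWith, List.sum_cons,
      List.sum_nil, mul_one, Matrix.cons_val_zero, Matrix.cons_val_one, Matrix.cons_val]
    linear_combination (norm := module) (1 : K) • h.r31
  · refine reducible_of_eq_sum _ _ [t, -u, v]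
      [[1, 1], [1], []] (by decide) ?_
    simp only [evalWord, List.map, List.prod_cons, List.prod_nil, List.zipWith, List.sum_cons,
      List.sum_nil, mul_one, Matrix.cons_val_zero, Matrix.cons_val_one, Matrix.cons_val]
    linear_combination (norm := module) (1 : K) • h.r333
  · refine reducible_of_eq_sum _ _ [1]
      [[1, 2, 1]] (by decide) ?_
    simp only [evalWord, List.map, List.prod_cons, List.prod_nil, List.zipWith, List.sum_cons,
      List.sum_nil, mul_one, Matrix.cons_val_zero, Matrix.cons_val_one, Matrix.cons_val]
    linear_combination (norm := module) (1 : K) • h.r232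
  · refine reducible_of_eq_sum _ _ [1, 1, -1, -1, 1]
      [[1, 1, 2], [0, 2, 2], [0, 1, 1], [0, 0, 2], [0, 0, 1]] (by decide) ?_
    simp only [evalWord, List.map, List.prod_cons, List.prod_nil, List.zipWith, List.sum_cons,
      List.sum_nil, mul_one, Matrix.cons_val_zero, Matrix.cons_val_one, Matrix.cons_val]
    linear_combination (norm := module) (1 : K) • h.r322
  · refine reducible_of_eq_sum _ _ [1, 1, -1, -1, 1]
      [[2, 1, 1], [0, 2, 2], [0, 1, 1], [0, 0, 2], [0, 0, 1]] (by decide) ?_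
    simp only [evalWord, List.map, List.prod_cons, List.prod_nil, List.zipWith, List.sum_cons,
      List.sum_nil, mul_one, Matrix.cons_val_zero, Matrix.cons_val_one, Matrix.cons_val]
    linear_combination (norm := module) (1 : K) • h.r223
  · refine reducible_of_eq_sum _ _ [1, 1, -1, -1, 1]
      [[1, 1, 2, 0], [0, 2, 0, 0], [0, 1, 1, 2], [0, 0, 2, 0], [0, 0, 1, 2]] (by decide) ?_
    simp only [evalWord, List.map, List.prod_cons, List.prod_nil, List.zipWith, List.sum_cons,
      List.sum_nil, mul_one, Matrix.cons_val_zero, Matrix.cons_val_one, Matrix.cons_val]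
    linear_combination (norm := module) (1 : K) • h.r3211
  · refine reducible_of_eq_sum _ _ [1, 1, -1, -1, 1]
      [[1, 1, 2, 1], [0, 2, 1, 1], [0, 1, 1, 2], [0, 0, 2, 1], [0, 0, 1, 2]] (by decide) ?_
    simp only [evalWord, List.map, List.prod_cons, List.prod_nil, List.zipWith, List.sum_cons,
      List.sum_nil, mul_one, Matrix.cons_val_zero, Matrix.cons_val_one, Matrix.cons_val]
    linear_combination (norm := module) (1 : K) • h.r3233
  · refine reducible_of_eq_sum _ _ [1, 1, -1, -1, 1]
      [[2, 0, 0, 1], [0, 2, 1, 1], [0, 2, 0, 0], [0, 0, 2, 1], [0, 0, 2, 0]] (by decide) ?_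
    simp only [evalWord, List.map, List.prod_cons, List.prod_nil, List.zipWith, List.sum_cons,
      List.sum_nil, mul_one, Matrix.cons_val_zero, Matrix.cons_val_one, Matrix.cons_val]
    linear_combination (norm := module) (1 : K) • h.r2133
  · refine reducible_of_eq_sum _ _ [1, 1, 1, -1, -t, u, -v]
      [[1, 1, 2, 1], [0, 2, 1, 1], [0, 0, 2, 2], [0, 0, 2, 1], [0, 2, 2], [0, 2], [0]] (by decide) ?_
    simp only [evalWord, List.map, List.prod_cons, List.prod_nil, List.zipWith, List.sum_cons,
      List.sum_nil, mul_one, Matrix.cons_val_zero, Matrix.cons_val_one, Matrix.cons_val]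
    linear_combination (norm := module) (1 : K) • h.r2332
  · refine reducible_of_eq_sum _ _ [1]
      [[0, 2, 0, 1, 2]] (by decide) ?_
    simp only [evalWord, List.map, List.prod_cons, List.prod_nil, List.zipWith, List.sum_cons,
      List.sum_nil, mul_one, Matrix.cons_val_zero, Matrix.cons_val_one, Matrix.cons_val]
    linear_combination (norm := module) (1 : K) • h.r21323
  · refine reducible_of_eq_sum _ _ [1, 1, -1, t, -t, -t, t, -u, u, v, -v]
      [[0, 2, 0, 0, 1], [0, 0, 2, 1, 1], [0, 0, 2, 0, 1], [2, 0, 0, 1], [0, 2, 0, 0], [0, 0, 2, 1], [0, 0, 2, 0], [2, 0, 1], [0, 2, 1], [2, 0], [0, 2]] (by decide) ?_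
    simp only [evalWord, List.map, List.prod_cons, List.prod_nil, List.zipWith, List.sum_cons,
      List.sum_nil, mul_one, Matrix.cons_val_zero, Matrix.cons_val_one, Matrix.cons_val]
    linear_combination (norm := module) (1 : K) • h.r21133
  · refine reducible_of_eq_sum _ _ [1]
      [[1, 2, 0, 1, 2]] (by decide) ?_
    simp only [evalWord, List.map, List.prod_cons, List.prod_nil, List.zipWith, List.sum_cons,
      List.sum_nil, mul_one, Matrix.cons_val_zero, Matrix.cons_val_one, Matrix.cons_val]
    linear_combination (norm := module) (1 : K) • h.r21321
  · refine reducible_of_eq_sum _ _ [1, 1, -t, -u, u, u, u, -u, v, -v, -v]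
      [[0, 2, 0, 0, 1, 2], [0, 0, 1, 1, 2, 1], [0, 1, 1, 2, 1], [0, 2, 1, 1], [0, 1, 2, 1], [0, 1, 1, 2], [0, 0, 2, 1], [0, 0, 1, 2], [2, 1, 1], [1, 1, 2], [0, 2, 1]] (by decide) ?_
    simp only [evalWord, List.map, List.prod_cons, List.prod_nil, List.zipWith, List.sum_cons,
      List.sum_nil, mul_one, Matrix.cons_val_zero, Matrix.cons_val_one, Matrix.cons_val]
    linear_combination (norm := module) (1 : K) • h.r211323
  · refine reducible_of_eq_sum _ _ [1, 1, -1, -1, -1, 1, 1, t, -t, -u, u, v, -v]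
      [[1, 1, 2, 0, 1, 2], [0, 2, 0, 0, 1, 2], [0, 1, 1, 2, 0, 1], [0, 0, 2, 0, 1, 2], [0, 0, 2, 0, 0, 1], [0, 0, 1, 2, 0, 1], [0, 0, 1, 1, 2, 1], [0, 0, 2, 0, 1], [0, 0, 1, 2, 1], [0, 2, 0, 1], [0, 1, 2, 1], [2, 0, 1], [1, 2, 1]] (by decide) ?_
    simp only [evalWord, List.map, List.prod_cons, List.prod_nil, List.zipWith, List.sum_cons,
      List.sum_nil, mul_one, Matrix.cons_val_zero, Matrix.cons_val_one, Matrix.cons_val]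
    linear_combination (norm := module) (1 : K) • h.r211321

end Dimensions

/-! ### Application to `Cubic` and `KAlg`. -/

section Concrete

variable {K : Type*} [Field K]

theorem adjoin_cubicGen (n : ℕ) (a b c : Kˣ) :
    Algebra.adjoin K (Set.range (cubicGen n a b c)) = ⊤ :=
  adjoin_eq_top n (cubicMk n a b c) (cubicMk_surjective n a b c) a b c (cubicGen_cubic n a b c)

theorem kGen_cubic (n : ℕ) (a b c : Kˣ) (i : Fin (n - 1)) :
    (kGen n a b c i - algebraMap K _ (a : K)) * (kGen n a b c i - algebraMap K _ (b : K)) *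
      (kGen n a b c i - algebraMap K _ (c : K)) = 0 := by
  have h := congrArg (kMk n a b c) (cubicGen_cubic n a b c i)
  simp only [map_mul, map_sub, AlgHom.commutes, map_zero] at h
  exact h

theorem adjoin_kGen (n : ℕ) (a b c : Kˣ) :
    Algebra.adjoin K (Set.range (kGen n a b c)) = ⊤ :=
  adjoin_eq_top n ((kMk n a b c).comp (cubicMk n a b c))
    ((kMk_surjective n a b c).comp (cubicMk_surjective n a b c)) a b c (kGen_cubic n a b c)

theorem isUnit_cubicGen (n : ℕ) (a b c : Kˣ) (i : Fin (n - 1)) : IsUnit (cubicGen n a b c i) :=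
  (isUnit_gen n i).map (cubicMk n a b c)

theorem isUnit_kGen (n : ℕ) (a b c : Kˣ) (i : Fin (n - 1)) : IsUnit (kGen n a b c i) :=
  (isUnit_cubicGen n a b c i).map (kMk n a b c)

theorem cubicGen_braid (n : ℕ) (a b c : Kˣ) (i j : Fin (n - 1)) (h : (i : ℕ) + 1 = j) :
    cubicGen n a b c i * cubicGen n a b c j * cubicGen n a b c i =
      cubicGen n a b c j * cubicGen n a b c i * cubicGen n a b c j := by
  have := congrArg (cubicMk n a b c) (gen_braid (K := K) n i j h)
  simp only [map_mul] at this
  exact this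

theorem kGen_braid (n : ℕ) (a b c : Kˣ) (i j : Fin (n - 1)) (h : (i : ℕ) + 1 = j) :
    kGen n a b c i * kGen n a b c j * kGen n a b c i =
      kGen n a b c j * kGen n a b c i * kGen n a b c j := by
  have := congrArg (kMk n a b c) (cubicGen_braid n a b c i j h)
  simp only [map_mul] at this
  exact this

theorem kGen_comm (n : ℕ) (a b c : Kˣ) (i j : Fin (n - 1)) (h : (i : ℕ) + 1 < j) :
    kGen n a b c i * kGen n a b c j = kGen n a b c j * kGen n a b c i := by
  have := congrArg (kMk n a b c) (congrArg (cubicMk n a b c) (gen_comm (K := K) n i j h))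
  simp only [map_mul] at this
  exact this

theorem map_bElement {A B : Type*} [Ring A] [Ring B] (f : A →+* B) (s t : A) :
    f (bElement s t) = bElement (f s) (f t) := by
  simp [bElement, Ring.lie_def]

theorem bElement_kGen (n : ℕ) (a b c : Kˣ) (h : 3 ≤ n) :
    bElement (kGen n a b c ⟨0, by omega⟩) (kGen n a b c ⟨1, by omega⟩) = 0 := by
  have h1 : kMk n a b c (bElement (cubicGen n a b c ⟨0, by omega⟩)
      (cubicGen n a b c ⟨1, by omega⟩)) = 0 :=
    (mk_eq_zero_iff _ _).2 (TwoSidedIdeal.subset_span ⟨h, rfl⟩)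
  exact (map_bElement (kMk n a b c : Cubic n a b c →+* KAlg n a b c) _ _).symm.trans h1

theorem cubicRules_cubicGen (a b c : Kˣ) :
    CubicRules (a + b + c : K) (a * b + b * c + a * c) (a * b * c)
      (cubicGen 3 a b c (0 : Fin 2)) (cubicGen 3 a b c (1 : Fin 2)) :=
  cubicRules_of (cubicGen_cubic 3 a b c (0 : Fin 2)) (cubicGen_cubic 3 a b c (1 : Fin 2))
    (cubicGen_braid 3 a b c (0 : Fin 2) (1 : Fin 2) rfl)

theorem finite_finrank_cubic_three (a b c : Kˣ) :
    Module.Finite K (Cubic 3 a b c) ∧ Module.finrank K (Cubic 3 a b c) ≤ 24 := by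
  refine (cubicRules_cubicGen a b c).finite_finrank_le (isUnit_cubicGen 3 a b c (0 : Fin 2))
    (a * b * c).ne_zero ?_
  rw [← adjoin_cubicGen]
  congr 2
  ext i
  fin_cases i <;> rfl

theorem threeRules_kGen (n : ℕ) (a b c : Kˣ) (h : 3 ≤ n) :
    ThreeRules (a + b + c : K) (a * b + b * c + a * c) (a * b * c)
      (kGen n a b c ⟨0, by omega⟩) (kGen n a b c ⟨1, by omega⟩) :=
  threeRules_of (cubicRules_of (kGen_cubic n a b c _) (kGen_cubic n a b c _)
    (kGen_braid n a b c _ _ rfl)) (bElement_kGen n a b c h)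

theorem finite_finrank_kAlg_three (a b c : Kˣ) :
    Module.Finite K (KAlg 3 a b c) ∧ Module.finrank K (KAlg 3 a b c) ≤ 15 := by
  refine (threeRules_kGen 3 a b c le_rfl).finite_finrank_le ?_
  rw [← adjoin_kGen]
  congr 2
  ext i
  fin_cases i <;> rfl

theorem fourRules_kGen (a b c : Kˣ) :
    FourRules (a + b + c : K) (a * b + b * c + a * c) (a * b * c)
      (kGen 4 a b c (0 : Fin 3)) (kGen 4 a b c (1 : Fin 3)) (kGen 4 a b c (2 : Fin 3)) :=
  fourRules_of (threeRules_kGen 4 a b c (by norm_num))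
    (cubicRules_of (kGen_cubic 4 a b c (1 : Fin 3)) (kGen_cubic 4 a b c (2 : Fin 3))
      (kGen_braid 4 a b c (1 : Fin 3) (2 : Fin 3) rfl))
    (isUnit_kGen _ _ _ _ _) (isUnit_kGen _ _ _ _ _) (isUnit_kGen _ _ _ _ _)
    (kGen_braid 4 a b c (0 : Fin 3) (1 : Fin 3) rfl)
    (kGen_braid 4 a b c (1 : Fin 3) (2 : Fin 3) rfl)
    (kGen_comm 4 a b c (0 : Fin 3) (2 : Fin 3) (by decide))
    (bElement_kGen 4 a b c (by norm_num))

theorem finite_finrank_kAlg_four (a b c : Kˣ) :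
    Module.Finite K (KAlg 4 a b c) ∧ Module.finrank K (KAlg 4 a b c) ≤ 69 := by
  refine (fourRules_kGen a b c).finite_finrank_le ?_
  rw [← adjoin_kGen]
  -- The counting used the order s₁, s₃, s₂, so the two families agree only as sets.
  congr 1
  ext x
  simp only [Set.mem_range]
  constructor
  · rintro ⟨i, rfl⟩
    fin_cases i
    · exact ⟨(0 : Fin 3), rfl⟩
    · exact ⟨(2 : Fin 3), rfl⟩
    · exact ⟨(1 : Fin 3), rfl⟩
  · rintro ⟨i, rfl⟩
    fin_cases i
    · exact ⟨0, rfl⟩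
    · exact ⟨2, rfl⟩
    · exact ⟨1, rfl⟩

theorem finite_finrank_kAlg_two (a b c : Kˣ) :
    Module.Finite K (KAlg 2 a b c) ∧ Module.finrank K (KAlg 2 a b c) ≤ 3 := by
  refine finite_and_finrank_le (K := K) (fun i : Fin 1 => kGen 2 a b c i) (adjoin_kGen 2 a b c)
    [[0, 0, 0]] 3 (by decide) ?_
  simp only [List.forall_mem_cons]
  refine ⟨?_, by simp⟩
  refine reducible_of_eq_sum _ _ [(a + b + c : K), -(a * b + b * c + a * c), a * b * c]
    [[0, 0], [0], []] (by decide) ?_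
  simp only [evalWord, List.map, List.prod_cons, List.prod_nil, List.zipWith, List.sum_cons,
    List.sum_nil, mul_one]
  linear_combination (norm := module) (1 : K) • cubic_expand (kGen_cubic 2 a b c (0 : Fin 1))

theorem finite_finrank_kAlg_of_le_one (n : ℕ) (hn : n ≤ 1) (a b c : Kˣ) :
    Module.Finite K (KAlg n a b c) ∧ Module.finrank K (KAlg n a b c) ≤ 1 := by
  have h0 : n - 1 = 0 := by omega
  have hg := adjoin_kGen n a b c
  have : IsEmpty (Fin (n - 1)) := by rw [h0]; infer_instance
  rw [Set.range_eq_empty (kGen n a b c), ← Set.range_eq_empty (Fin.elim0 : Fin 0 → _)] at hg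
  exact finite_and_finrank_le _ hg [] 1 (by decide) (by simp)

theorem relations₃_of_threeRules {A : Type*} [Ring A] [Algebra K A] {a b c : K} {s₁ s₂ : A}
    (hc₁ : (s₁ - algebraMap K A a) * (s₁ - algebraMap K A b) * (s₁ - algebraMap K A c) = 0)
    (hc₂ : (s₂ - algebraMap K A a) * (s₂ - algebraMap K A b) * (s₂ - algebraMap K A c) = 0)
    (h : ThreeRules (a + b + c) (a * b + b * c + a * c) (a * b * c) s₁ s₂)
    (hb : bElement s₁ s₂ = 0) : Relations₃ a b c s₁ s₂ where
  cubic₁ := hc₁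
  cubic₂ := hc₂
  bracket := sub_eq_zero.1 hb
  ternary := by
    simp only [pow_two, mul_assoc]
    linear_combination (norm := module) (1 : K) • h.r2112

/-- Both sides of each relation reduce to the same combination of words under the rewriting rules.
-/
theorem relations₄_of_fourRules {A : Type*} [Ring A] [Algebra K A] {a b c : K} {s₁ s₂ s₃ : A}
    (h : FourRules (a + b + c) (a * b + b * c + a * c) (a * b * c) s₁ s₂ s₃) :
    Relations₄ a b c s₁ s₂ s₃ := by
  constructor <;>
  · simp only [pow_two, mul_assoc, h.r31, asc2 h.r31, asc3 h.r221]
    simp only [mul_add, add_mul, mul_sub, sub_mul, neg_mul, mul_neg, smul_mul_assoc, mul_smul_comm,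
      mul_one, one_mul, smul_add, smul_sub, mul_assoc,
      h.r111, h.r212, h.r222, h.r221, h.r2112, h.r31, h.r333, h.r232, h.r322,
      h.r223, h.r3211, h.r3233, h.r2133, h.r2332, asc3 h.r111, asc3 h.r212, asc3 h.r222,
      asc3 h.r221, asc4 h.r2112, asc2 h.r31, asc3 h.r333, asc3 h.r232, asc3 h.r322, asc3 h.r223]
    module

end Concrete

/-! ### The regular representation of the quadratic Hecke algebras -/

section Regular

variable {K : Type*} [Field K] {n : ℕ}

/-- The position `i`, among `n`, of the generator `i`. -/
def posL (i : Fin (n - 1)) : Fin n := ⟨i, by omega⟩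

/-- The position `i + 1`, among `n`, of the generator `i`. -/
def posR (i : Fin (n - 1)) : Fin n := ⟨i + 1, by omega⟩

theorem posL_ne_posR (i : Fin (n - 1)) : posL i ≠ posR i := by
  simp [posL, posR]

/-- The simple transposition attached to a generator. -/
def adjSwap (i : Fin (n - 1)) : Equiv.Perm (Fin n) := Equiv.swap (posL i) (posR i)

theorem adjSwap_mul_self (i : Fin (n - 1)) : adjSwap i * adjSwap i = 1 :=
  Equiv.swap_mul_self _ _

/-- The action of a generator on the regular representation of the quadratic Hecke algebra with
parameters `x, y`. -/
def heckeOp (x y : K) (i : Fin (n - 1)) : Module.End K (Equiv.Perm (Fin n) →₀ K) :=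
  Finsupp.linearCombination K fun w =>
    -- Right multiplication by T_i on the basis T_w. An ascent gives T_{w s_i}; at a descent T_w =
    -- T_{w s_i} T_i, and T_i² = (x + y) T_i - xy is applied.
    if w (posL i) < w (posR i) then Finsupp.single (w * adjSwap i) 1
    else (x + y) • Finsupp.single w 1 - (x * y) • Finsupp.single (w * adjSwap i) 1

theorem heckeOp_of_lt (x y : K) {i : Fin (n - 1)} {w : Equiv.Perm (Fin n)}
    (h : w (posL i) < w (posR i)) :
    heckeOp x y i (Finsupp.single w 1) = Finsupp.single (w * adjSwap i) 1 := by
  rw [heckeOp, Finsupp.linearCombination_single, one_smul, if_pos h]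

theorem heckeOp_of_gt (x y : K) {i : Fin (n - 1)} {w : Equiv.Perm (Fin n)}
    (h : w (posR i) < w (posL i)) :
    heckeOp x y i (Finsupp.single w 1) =
      (x + y) • Finsupp.single w 1 - (x * y) • Finsupp.single (w * adjSwap i) 1 := by
  rw [heckeOp, Finsupp.linearCombination_single, one_smul, if_neg h.not_gt]

theorem perm_lt_or_gt (w : Equiv.Perm (Fin n)) {p q : Fin n} (h : p ≠ q) :
    w p < w q ∨ w q < w p :=
  lt_or_gt_of_ne (w.injective.ne h)

theorem mul_adjSwap_posL (w : Equiv.Perm (Fin n)) (i : Fin (n - 1)) :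
    (w * adjSwap i) (posL i) = w (posR i) := by
  simp [adjSwap]

theorem mul_adjSwap_posR (w : Equiv.Perm (Fin n)) (i : Fin (n - 1)) :
    (w * adjSwap i) (posR i) = w (posL i) := by
  simp [adjSwap]

theorem heckeOp_quadratic (x y : K) (i : Fin (n - 1)) :
    heckeOp x y i * heckeOp x y i =
      (x + y) • heckeOp x y i - (x * y) • (1 : Module.End K (Equiv.Perm (Fin n) →₀ K)) := by
  refine Finsupp.lhom_ext' fun w => LinearMap.ext_ring ?_
  simp only [LinearMap.comp_apply, Finsupp.lsingle_apply, Module.End.mul_apply,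
    LinearMap.sub_apply, LinearMap.smul_apply, Module.End.one_apply]
  rcases perm_lt_or_gt w (posL_ne_posR i) with h | h
  · have h' : (w * adjSwap i) (posR i) < (w * adjSwap i) (posL i) := by
      rwa [mul_adjSwap_posL, mul_adjSwap_posR]
    rw [heckeOp_of_lt x y h, heckeOp_of_gt x y h', mul_assoc, adjSwap_mul_self, mul_one]
  · have h' : (w * adjSwap i) (posL i) < (w * adjSwap i) (posR i) := by
      rwa [mul_adjSwap_posL, mul_adjSwap_posR]
    rw [heckeOp_of_gt x y h]
    simp only [map_sub, map_smul]
    rw [heckeOp_of_gt x y h, heckeOp_of_lt x y h', mul_assoc w, adjSwap_mul_self, mul_one]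

theorem heckeOp_comm (x y : K) (i j : Fin (n - 1)) (h : (i : ℕ) + 1 < j) :
    heckeOp x y i * heckeOp x y j = heckeOp x y j * heckeOp x y i := by
  have e1 : posL j ≠ posL i := by simp [posL, Fin.ext_iff]; omega
  have e2 : posL j ≠ posR i := by simp [posL, posR, Fin.ext_iff]; omega
  have e3 : posR j ≠ posL i := by simp [posL, posR, Fin.ext_iff]; omega
  have e4 : posR j ≠ posR i := by simp [posR, Fin.ext_iff]; omega
  have c : adjSwap j * adjSwap i = adjSwap i * adjSwap j := by
    refine Equiv.Perm.Disjoint.commute ?_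
    intro z
    by_cases hz : z = posL i ∨ z = posR i
    · left
      rcases hz with rfl | rfl
      · exact Equiv.swap_apply_of_ne_of_ne e1.symm e3.symm
      · exact Equiv.swap_apply_of_ne_of_ne e2.symm e4.symm
    · right
      push Not at hz
      exact Equiv.swap_apply_of_ne_of_ne hz.1 hz.2
  have a1 : ∀ w : Equiv.Perm (Fin n), (w * adjSwap i) (posL j) = w (posL j) := fun w => by
    simp [adjSwap, Equiv.swap_apply_of_ne_of_ne e1 e2]
  have a2 : ∀ w : Equiv.Perm (Fin n), (w * adjSwap i) (posR j) = w (posR j) := fun w => by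
    simp [adjSwap, Equiv.swap_apply_of_ne_of_ne e3 e4]
  have a3 : ∀ w : Equiv.Perm (Fin n), (w * adjSwap j) (posL i) = w (posL i) := fun w => by
    simp [adjSwap, Equiv.swap_apply_of_ne_of_ne e1.symm e3.symm]
  have a4 : ∀ w : Equiv.Perm (Fin n), (w * adjSwap j) (posR i) = w (posR i) := fun w => by
    simp [adjSwap, Equiv.swap_apply_of_ne_of_ne e2.symm e4.symm]
  refine Finsupp.lhom_ext' fun w => LinearMap.ext_ring ?_
  simp only [LinearMap.comp_apply, Finsupp.lsingle_apply, Module.End.mul_apply]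
  rcases perm_lt_or_gt w (posL_ne_posR i) with h1 | h1 <;>
  rcases perm_lt_or_gt w (posL_ne_posR j) with h2 | h2 <;>
  simp only [heckeOp_of_lt, heckeOp_of_gt, h1, h2, a1, a2, a3, a4, map_sub, map_smul, mul_assoc, c]
  module

theorem heckeOp_braid (x y : K) (i j : Fin (n - 1)) (h : (i : ℕ) + 1 = j) :
    heckeOp x y i * heckeOp x y j * heckeOp x y i =
      heckeOp x y j * heckeOp x y i * heckeOp x y j := by
  have e : posL j = posR i := by simp [posL, posR, Fin.ext_iff]; omega
  have e1 : posR j ≠ posL i := by simp [posL, posR, Fin.ext_iff]; omega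
  have e2 : posR j ≠ posR i := by simp [posR, Fin.ext_iff]; omega
  have e3 := posL_ne_posR i
  have c : adjSwap j * (adjSwap i * adjSwap j) = adjSwap i * (adjSwap j * adjSwap i) := by
    unfold adjSwap
    have c1 := Equiv.swap_mul_swap_mul_swap e3 e1.symm
    have c2 := Equiv.swap_mul_swap_mul_swap e2 e1
    rw [Equiv.swap_comm (posR j) (posR i), Equiv.swap_comm (posR i) (posL i)] at c2
    rw [e, ← mul_assoc, ← mul_assoc, c1, c2, Equiv.swap_comm]
  have a1 : ∀ w : Equiv.Perm (Fin n), (w * adjSwap i) (posL i) = w (posR i) :=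
    fun w => mul_adjSwap_posL w i
  have a2 : ∀ w : Equiv.Perm (Fin n), (w * adjSwap i) (posR i) = w (posL i) :=
    fun w => mul_adjSwap_posR w i
  have a3 : ∀ w : Equiv.Perm (Fin n), (w * adjSwap i) (posR j) = w (posR j) := fun w => by
    simp [adjSwap, Equiv.swap_apply_of_ne_of_ne e1 e2]
  have b1 : ∀ w : Equiv.Perm (Fin n), (w * adjSwap j) (posL i) = w (posL i) := fun w => by
    simp [adjSwap, e, Equiv.swap_apply_of_ne_of_ne e3 e1.symm]
  have b2 : ∀ w : Equiv.Perm (Fin n), (w * adjSwap j) (posR i) = w (posR j) := fun w => by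
    rw [← e]; exact mul_adjSwap_posL w j
  have b3 : ∀ w : Equiv.Perm (Fin n), (w * adjSwap j) (posR j) = w (posR i) := fun w => by
    rw [← e]; exact mul_adjSwap_posR w j
  have li : ∀ w : Equiv.Perm (Fin n), w (posL i) < w (posR i) →
      heckeOp x y i (Finsupp.single w 1) = Finsupp.single (w * adjSwap i) 1 :=
    fun w => heckeOp_of_lt x y
  have gi : ∀ w : Equiv.Perm (Fin n), w (posR i) < w (posL i) →
      heckeOp x y i (Finsupp.single w 1) =
      (x + y) • Finsupp.single w 1 - (x * y) • Finsupp.single (w * adjSwap i) 1 :=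
    fun w => heckeOp_of_gt x y
  have lj : ∀ w : Equiv.Perm (Fin n), w (posR i) < w (posR j) →
      heckeOp x y j (Finsupp.single w 1) = Finsupp.single (w * adjSwap j) 1 :=
    fun w hw => heckeOp_of_lt x y (by rwa [e])
  have gj : ∀ w : Equiv.Perm (Fin n), w (posR j) < w (posR i) →
      heckeOp x y j (Finsupp.single w 1) =
      (x + y) • Finsupp.single w 1 - (x * y) • Finsupp.single (w * adjSwap j) 1 :=
    fun w hw => heckeOp_of_gt x y (by rwa [e])
  refine Finsupp.lhom_ext' fun w => LinearMap.ext_ring ?_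
  simp only [LinearMap.comp_apply, Finsupp.lsingle_apply, Module.End.mul_apply]
  -- The relative order of three values of `w` gives eight sign patterns; two are cyclic and
  -- contradictory, and the other six are direct computations.
  rcases perm_lt_or_gt w e3 with h1 | h1 <;>
  rcases perm_lt_or_gt w e2.symm with h2 | h2 <;>
  rcases perm_lt_or_gt w e1.symm with h3 | h3 <;>
  first
  | exact absurd (h1.trans (h2.trans h3)) (lt_irrefl _)
  | exact absurd (h1.trans (h3.trans h2)) (lt_irrefl _)
  | (simp only [li, gi, lj, gj, a1, a2, a3, b1, b2, b3, h1, h2, h3, map_sub, map_smul]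
     simp only [mul_assoc, c, adjSwap_mul_self, mul_one]
     try module)

section Quadratic

variable {E : Type*} [Ring E] [Algebra K E]

theorem mul_eq_one_of_quadratic (x y : Kˣ) {T : E}
    (h : T * T = ((x : K) + y) • T - ((x : K) * y) • (1 : E)) :
    T * (((x * y)⁻¹ : Kˣ).val • (((x : K) + y) • 1 - T)) = 1 := by
  rw [mul_smul_comm, mul_sub, h, mul_smul_comm, mul_one, sub_sub_cancel, smul_smul,
    ← Units.val_mul, ← Units.val_mul, inv_mul_cancel, Units.val_one, one_smul]

theorem mul_eq_one_of_quadratic' (x y : Kˣ) {T : E}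
    (h : T * T = ((x : K) + y) • T - ((x : K) * y) • (1 : E)) :
    (((x * y)⁻¹ : Kˣ).val • (((x : K) + y) • 1 - T)) * T = 1 := by
  rw [smul_mul_assoc, sub_mul, h, smul_mul_assoc, one_mul, sub_sub_cancel, smul_smul,
    ← Units.val_mul, ← Units.val_mul, inv_mul_cancel, Units.val_one, one_smul]

theorem quadratic_factor {x y : K} {T : E} (h : T * T = (x + y) • T - (x * y) • (1 : E)) :
    (T - algebraMap K E x) * (T - algebraMap K E y) = 0 := by
  simp only [Algebra.algebraMap_eq_smul_one, mul_sub, sub_mul, smul_mul_assoc, mul_smul_comm,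
    one_mul, mul_one, h]
  module

end Quadratic

/-- The invertible operator given by a generator. -/
def heckeUnit (x y : Kˣ) (i : Fin (n - 1)) : (Module.End K (Equiv.Perm (Fin n) →₀ K))ˣ where
  val := heckeOp (x : K) y i
  inv := ((x * y)⁻¹ : Kˣ).val • (((x : K) + y) • 1 - heckeOp (x : K) y i)
  val_inv := mul_eq_one_of_quadratic (E := Module.End K (Equiv.Perm (Fin n) →₀ K)) x y
    (heckeOp_quadratic _ _ _)
  inv_val := mul_eq_one_of_quadratic' (E := Module.End K (Equiv.Perm (Fin n) →₀ K)) x y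
    (heckeOp_quadratic _ _ _)

/-- The regular representation of the quadratic Hecke algebra, on the group algebra of `B_n`. -/
def heckeRep (n : ℕ) (x y : Kˣ) : BraidAlgebra K n →ₐ[K] Module.End K (Equiv.Perm (Fin n) →₀ K) :=
  MonoidAlgebra.lift K _ (BraidGroup n) ((Units.coeHom _).comp
    (PresentedGroup.toGroup (f := heckeUnit x y) (by
      rintro _ (⟨i, j, h⟩ | ⟨i, j, h⟩)
      · simp only [map_mul, map_inv, FreeGroup.lift_apply_of]
        rw [mul_inv_eq_one]
        ext1
        exact heckeOp_braid (x : K) y i j h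
      · simp only [map_mul, map_inv, FreeGroup.lift_apply_of]
        rw [mul_inv_eq_one]
        ext1
        exact heckeOp_comm (x : K) y i j h)))

theorem heckeRep_gen (x y : Kˣ) (i : Fin (n - 1)) :
    heckeRep n x y (gen K n i) = heckeOp (x : K) y i := by
  simp only [heckeRep, gen, MonoidAlgebra.lift_of, MonoidHom.comp_apply, Units.coeHom_apply,
    PresentedGroup.toGroup.of]
  rfl

/-- The orbit map of the cyclic vector of the regular representation. -/
def heckeOrbit (n : ℕ) (x y : Kˣ) : BraidAlgebra K n →ₗ[K] (Equiv.Perm (Fin n) →₀ K) :=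
  (LinearMap.applyₗ (Finsupp.single 1 1)).comp (heckeRep n x y).toLinearMap

theorem heckeOrbit_mul (x y : Kˣ) (u v : BraidAlgebra K n) :
    heckeOrbit n x y (u * v) = heckeRep n x y u (heckeOrbit n x y v) := by
  simp [heckeOrbit]

theorem heckeRep_eq_zero (x y : Kˣ) {u : BraidAlgebra K n} (hu : u ∈ quadraticIdeal n (x : K) y) :
    heckeRep n x y u = 0 := by
  have h : quadraticIdeal n (x : K) y ≤ TwoSidedIdeal.ker (heckeRep n x y) := by
    refine TwoSidedIdeal.span_le.2 ?_
    rintro _ ⟨i, rfl⟩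
    refine (TwoSidedIdeal.mem_ker _).2 ?_
    rw [map_mul, map_sub, map_sub, AlgHom.commutes, AlgHom.commutes, heckeRep_gen]
    exact quadratic_factor (E := Module.End K (Equiv.Perm (Fin n) →₀ K)) (heckeOp_quadratic _ _ _)
  exact (TwoSidedIdeal.mem_ker _).1 (h hu)

theorem heckeOrbit_eq_zero (x y : Kˣ) {u : BraidAlgebra K n} (hu : u ∈ quadraticIdeal n (x : K) y) :
    heckeOrbit n x y u = 0 := by
  simp [heckeOrbit, heckeRep_eq_zero x y hu]

/-- The range contains the basis vector at 1 and is stable under the operators. From w it reaches w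
s_i directly at an ascent, and at a descent by solving the defining formula, since xy is invertible;
simple transpositions generate the symmetric group. -/
theorem heckeOrbit_surjective (n : ℕ) (x y : Kˣ) : Function.Surjective (heckeOrbit n x y) := by
  rw [← LinearMap.range_eq_top]
  set U := LinearMap.range (heckeOrbit n x y)
  have hop : ∀ i, ∀ z ∈ U, heckeOp (x : K) y i z ∈ U := by
    rintro i _ ⟨u, rfl⟩
    exact ⟨gen K n i * u, by rw [heckeOrbit_mul, heckeRep_gen]⟩
  have hstep : ∀ i w, Finsupp.single w 1 ∈ U → Finsupp.single (w * adjSwap i) 1 ∈ U := by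
    intro i w hw
    rcases perm_lt_or_gt w (posL_ne_posR i) with h | h
    · rw [← heckeOp_of_lt (x : K) y h]
      exact hop i _ hw
    · have h1 := U.smul_mem ((x * y)⁻¹ : Kˣ).val
        (U.sub_mem (U.smul_mem ((x : K) + y) hw) (hop i _ hw))
      rwa [heckeOp_of_gt (x : K) y h, sub_sub_cancel, smul_smul, ← Units.val_mul, ← Units.val_mul,
        inv_mul_cancel, Units.val_one, one_smul] at h1
  have hone : Finsupp.single 1 1 ∈ U := ⟨1, by simp [heckeOrbit]⟩
  have hall : ∀ w : Equiv.Perm (Fin n), Finsupp.single w 1 ∈ U := by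
    intro w
    cases n with
    | zero => rwa [Subsingleton.elim w 1]
    | succ n =>
      have hw : w ∈ Submonoid.closure (Set.range fun i : Fin n => Equiv.swap i.castSucc i.succ) := by
        rw [Equiv.Perm.mclosure_swap_castSucc_succ]; trivial
      induction hw using Submonoid.closure_induction_right with
      | one => exact hone
      | mul_right w _ s hs ih =>
        obtain ⟨i, rfl⟩ := hs
        exact hstep i w ih
  rw [eq_top_iff]
  intro z _
  rw [← Finsupp.sum_single z]
  refine U.sum_mem fun w _ => ?_
  have := U.smul_mem (z w) (hall w)
  simpa using this

end Regular

/-! ### A lower bound for the dimension of the tripled algebra -/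

section Dimension

variable {K : Type*} [Field K]

theorem finrank_map_add_finrank_inf_ker {V W : Type*} [AddCommGroup V] [Module K V]
    [FiniteDimensional K V] [AddCommGroup W] [Module K W] (f : V →ₗ[K] W) (p : Submodule K V) :
    Module.finrank K (p.map f) + Module.finrank K (p ⊓ LinearMap.ker f : Submodule K V) =
      Module.finrank K p := by
  have h := LinearMap.finrank_range_add_finrank_ker (f.domRestrict p)
  rw [LinearMap.range_domRestrict, LinearMap.ker_domRestrict] at h
  rw [← h, ← Submodule.map_comap_subtype,
    ← (Submodule.equivMapOfInjective p.subtype p.injective_subtype _).finrank_eq]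

theorem le_finrank_of_sup_span_eq_top {W : Type*} [AddCommGroup W] [Module K W]
    [FiniteDimensional K W] (U : Submodule K W) (s : Finset W)
    (h : U ⊔ Submodule.span K (s : Set W) = ⊤) :
    Module.finrank K W - s.card ≤ Module.finrank K U := by
  have h1 := Submodule.finrank_add_le_finrank_add_finrank U (Submodule.span K (s : Set W))
  rw [h, finrank_top] at h1
  have h2 : Module.finrank K (Submodule.span K (s : Set W)) ≤ s.card :=
    finrank_span_finset_le_card s
  omega

/-- If `f₁` is onto, and `f₂`, `f₃` are onto up to one, resp. two, dimensions on the kernel of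
the previous maps, then the dimension of the source is bounded below. -/
theorem le_finrank_of_three_maps {V W : Type*} [AddCommGroup V] [Module K V]
    [FiniteDimensional K V] [AddCommGroup W] [Module K W] [FiniteDimensional K W]
    (f₁ f₂ f₃ : V →ₗ[K] W) (h₁ : Function.Surjective f₁) (s₂ s₃ : Finset W) (hs₂ : s₂.card ≤ 1)
    (hs₃ : s₃.card ≤ 2)
    (h₂ : (LinearMap.ker f₁).map f₂ ⊔ Submodule.span K (s₂ : Set W) = ⊤)
    (h₃ : (LinearMap.ker f₁ ⊓ LinearMap.ker f₂).map f₃ ⊔ Submodule.span K (s₃ : Set W) = ⊤) :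
    Module.finrank K W + (Module.finrank K W - 1) + (Module.finrank K W - 2) ≤
      Module.finrank K V := by
  have e1 := LinearMap.finrank_range_add_finrank_ker f₁
  rw [LinearMap.range_eq_top.2 h₁, finrank_top] at e1
  have e2 := finrank_map_add_finrank_inf_ker f₂ (LinearMap.ker f₁)
  have e3 := finrank_map_add_finrank_inf_ker f₃ (LinearMap.ker f₁ ⊓ LinearMap.ker f₂)
  have l2 := le_finrank_of_sup_span_eq_top _ _ h₂
  have l3 := le_finrank_of_sup_span_eq_top _ _ h₃
  omega

theorem braidAlgebra_hom_ext {A : Type*} [Ring A] [Algebra K A] {n : ℕ}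
    {φ ψ : BraidAlgebra K n →ₐ[K] A} (h : ∀ i, φ (gen K n i) = ψ (gen K n i)) : φ = ψ := by
  refine AlgHom.ext fun u => ?_
  induction u using MonoidAlgebra.induction_on with
  | of x =>
    exact PresentedGroup.generated_by {w | BraidRelation n w}
      (((φ : BraidAlgebra K n →* A).comp (MonoidAlgebra.of K (BraidGroup n))).eqLocus
        ((ψ : BraidAlgebra K n →* A).comp (MonoidAlgebra.of K (BraidGroup n)))) h x
  | add x y hx hy => rw [map_add, map_add, hx, hy]
  | smul r x hx => rw [map_smul, map_smul, hx]

/-- The character of `K B_n` with value `x` on the Artin generators. -/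
def character (n : ℕ) (x : Kˣ) : BraidAlgebra K n →ₐ[K] K :=
  MonoidAlgebra.lift K K (BraidGroup n) ((Units.coeHom K).comp
    (PresentedGroup.toGroup (f := fun _ => x) (by
      rintro _ (⟨i, j, h⟩ | ⟨i, j, h⟩) <;> simp)))

theorem character_gen (n : ℕ) (x : Kˣ) (i : Fin (n - 1)) : character n x (gen K n i) = x := by
  simp only [character, gen, MonoidAlgebra.lift_of, MonoidHom.comp_apply, Units.coeHom_apply,
    PresentedGroup.toGroup.of]

/-- Modulo `I` every generator becomes the scalar `x`, so the quotient map factors through the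
character. -/
theorem sub_character_mem (n : ℕ) (x : Kˣ) (I : TwoSidedIdeal (BraidAlgebra K n))
    (hI : ∀ i, gen K n i - algebraMap K _ (x : K) ∈ I) (u : BraidAlgebra K n) :
    u - algebraMap K _ (character n x u) ∈ I := by
  have h : I.ringCon.mkₐ K =
      (Algebra.ofId K I.ringCon.Quotient).comp (character n x) := by
    refine braidAlgebra_hom_ext fun i => ?_
    rw [AlgHom.comp_apply, character_gen]
    have := (mk_eq_zero_iff (R := K) I _).2 (hI i)
    rw [map_sub, AlgHom.commutes, sub_eq_zero] at this
    exact this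
  have h' := DFunLike.congr_fun h u
  rw [← mk_eq_zero_iff (R := K), map_sub, AlgHom.commutes, h', sub_eq_zero]
  rfl

theorem quadraticIdeal_comm (n : ℕ) (x y : K) : quadraticIdeal n x y = quadraticIdeal n y x := by
  unfold quadraticIdeal
  congr 1
  congr 1
  funext i
  simp only [Algebra.algebraMap_eq_smul_one, mul_sub, sub_mul, smul_mul_assoc, mul_smul_comm,
    one_mul, mul_one]
  module

/-- The difference (s - x)(s - y) - (s - x)(s - z) equals (z - y)(s - x), and z - y is invertible.
-/
theorem gen_sub_mem_sup (n : ℕ) {x y z : K} (h : y ≠ z) (i : Fin (n - 1)) :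
    gen K n i - algebraMap K _ x ∈ quadraticIdeal n x y ⊔ quadraticIdeal n x z := by
  have h1 : (gen K n i - algebraMap K _ x) * (gen K n i - algebraMap K _ y) ∈
      quadraticIdeal n x y ⊔ quadraticIdeal n x z :=
    TwoSidedIdeal.mem_sup_left (TwoSidedIdeal.subset_span ⟨i, rfl⟩)
  have h2 : (gen K n i - algebraMap K _ x) * (gen K n i - algebraMap K _ z) ∈
      quadraticIdeal n x y ⊔ quadraticIdeal n x z :=
    TwoSidedIdeal.mem_sup_right (TwoSidedIdeal.subset_span ⟨i, rfl⟩)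
  have h3 := TwoSidedIdeal.mul_mem_left _ (algebraMap K _ (z - y)⁻¹) _
    (TwoSidedIdeal.sub_mem _ h1 h2)
  convert h3 using 1
  rw [← mul_sub, sub_sub_sub_cancel_left, ← map_sub, ← Algebra.commutes, ← mul_assoc, ← map_mul,
    inv_mul_cancel₀ (sub_ne_zero.2 h.symm), map_one, one_mul]

/-- The orbit map of the regular representation, on the tripled algebra. -/
theorem exists_orbit_map (n : ℕ) (a b c x y : Kˣ)
    (h : tripledIdeal n a b c ≤ quadraticIdeal n (x : K) y) :
    ∃ f : Tripled n a b c →ₗ[K] (Equiv.Perm (Fin n) →₀ K),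
      ∀ u, f (tripledMk n a b c u) = heckeOrbit n x y u := by
  have hle : (tripledIdeal n a b c).ringCon ≤ RingCon.ker (heckeRep n x y).toRingHom := by
    intro u v huv
    have h1 := heckeRep_eq_zero x y (h ((TwoSidedIdeal.rel_iff _ u v).1 huv))
    rw [map_sub, sub_eq_zero] at h1
    exact h1
  exact ⟨(LinearMap.applyₗ (Finsupp.single 1 1)).comp
    (RingCon.liftₐ (tripledIdeal n a b c).ringCon (heckeRep n x y) hle).toLinearMap, fun _ => rfl⟩

/-- Moves the codimension estimate to the group algebra: each `u` only has to be corrected by an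
element whose class lies in `U`, up to the span of the exceptional vectors. -/
theorem sup_span_eq_top_of_surjective {A W Q : Type*} [AddCommGroup A] [Module K A]
    [AddCommGroup W] [Module K W] [AddCommGroup Q] [Module K Q] (π : A → Q) (ψ : A →ₗ[K] W)
    (f : Q →ₗ[K] W) (hf : ∀ u, f (π u) = ψ u) (hψ : Function.Surjective ψ) (U : Submodule K Q)
    (s : Set W)
    (h : ∀ u, ∃ v, π v ∈ U ∧ ψ u - ψ v ∈ Submodule.span K s) :
    U.map f ⊔ Submodule.span K s = ⊤ := by
  rw [eq_top_iff]
  rintro w -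
  obtain ⟨u, rfl⟩ := hψ w
  obtain ⟨v, hv, hs⟩ := h u
  rw [← add_sub_cancel (ψ v) (ψ u)]
  exact Submodule.add_mem_sup ⟨π v, hv, hf v⟩ hs

/-- Write J_xy for the ideals. Since J_ab + J_ac has codimension at most one, the second orbit map
restricted to the kernel of the first misses at most the line of the image of 1. For the third, 1 is
split along the three ideals, and products from J_ab and J_ac, which lie in both, account for all
but two dimensions. -/
theorem le_finrank_tripled (n : ℕ) (a b c : Kˣ) (hab : a ≠ b) (hac : a ≠ c) (hbc : b ≠ c)
    [FiniteDimensional K (Tripled n a b c)] :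
    n.factorial + (n.factorial - 1) + (n.factorial - 2) ≤ Module.finrank K (Tripled n a b c) := by
  have hab' : (a : K) ≠ b := fun h => hab (Units.ext h)
  have hac' : (a : K) ≠ c := fun h => hac (Units.ext h)
  have hbc' : (b : K) ≠ c := fun h => hbc (Units.ext h)
  have hW : Module.finrank K (Equiv.Perm (Fin n) →₀ K) = n.factorial := by
    rw [Module.finrank_finsupp_self, Fintype.card_perm, Fintype.card_fin]
  obtain ⟨f₁, hf₁⟩ := exists_orbit_map n a b c a b (inf_le_left.trans inf_le_left)
  obtain ⟨f₂, hf₂⟩ := exists_orbit_map n a b c a c (inf_le_left.trans inf_le_right)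
  obtain ⟨f₃, hf₃⟩ := exists_orbit_map n a b c b c inf_le_right
  have ha := sub_character_mem n a _ (gen_sub_mem_sup n hbc')
  have hb := sub_character_mem n b _ (gen_sub_mem_sup n hac')
  have hc := sub_character_mem n c _ (gen_sub_mem_sup n hab')
  rw [quadraticIdeal_comm n (b : K) a] at hb
  rw [quadraticIdeal_comm n (c : K) a, quadraticIdeal_comm n (c : K) b] at hc
  simp only [TwoSidedIdeal.mem_sup] at ha hb hc
  have hs₁ : Function.Surjective f₁ := fun w => by
    obtain ⟨u, rfl⟩ := heckeOrbit_surjective n a b w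
    exact ⟨_, hf₁ u⟩
  classical
  rw [← hW]
  have k₂ : (LinearMap.ker f₁).map f₂ ⊔ Submodule.span K
      (({heckeOrbit n a c 1} : Finset _) : Set (Equiv.Perm (Fin n) →₀ K)) = ⊤ := by
    refine sup_span_eq_top_of_surjective (tripledMk n a b c) _ f₂ hf₂
      (heckeOrbit_surjective n a c) _ _ fun u => ?_
    obtain ⟨p, hp, q, hq, hpq⟩ := ha u
    refine ⟨p, ?_, ?_⟩
    · rw [LinearMap.mem_ker, hf₁]
      exact heckeOrbit_eq_zero a b hp
    · have : u - p = character n a u • 1 + q := by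
        rw [← Algebra.algebraMap_eq_smul_one, sub_eq_iff_eq_add, add_assoc, add_comm q p, hpq,
          add_sub_cancel]
      rw [← map_sub, this, map_add, map_smul, heckeOrbit_eq_zero a c hq, add_zero]
      exact Submodule.smul_mem _ _ (Submodule.subset_span (by simp))
  -- Without generators 1 cannot be split along the ideals, but truncated subtraction makes the
  -- bound 1 + 0 + 0, so the first map suffices.
  rcases le_or_gt n 1 with hn | hn
  · have h1 : n.factorial = 1 := by
      interval_cases n <;> rfl
    rw [hW, h1]
    have := LinearMap.finrank_le_finrank_of_surjective hs₁
    rw [hW, h1] at this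
    simpa using this
  set i : Fin (n - 1) := ⟨0, by omega⟩
  have hone : ∃ p ∈ quadraticIdeal n (a : K) b, ∃ q ∈ quadraticIdeal n (a : K) c,
      ∃ r ∈ quadraticIdeal n (b : K) c, p + q + r = 1 := by
    -- The constant c - b is (s - b) - (s - c), with s - b in J_ab + J_bc and s - c in J_ac + J_bc.
    have h1 := gen_sub_mem_sup (x := (b : K)) (y := a) (z := c) n hac' i
    have h2 := gen_sub_mem_sup (x := (c : K)) (y := a) (z := b) n hab' i
    rw [quadraticIdeal_comm n (b : K) a] at h1
    rw [quadraticIdeal_comm n (c : K) a, quadraticIdeal_comm n (c : K) b] at h2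
    obtain ⟨p, hp, r, hr, h1⟩ := TwoSidedIdeal.mem_sup.1 h1
    obtain ⟨q, hq, t, ht, h2⟩ := TwoSidedIdeal.mem_sup.1 h2
    set e := algebraMap K (BraidAlgebra K n) ((c : K) - b)⁻¹
    refine ⟨e * p, TwoSidedIdeal.mul_mem_left _ _ _ hp, e * (-q),
      TwoSidedIdeal.mul_mem_left _ _ _ (TwoSidedIdeal.neg_mem _ hq), e * (r - t),
      TwoSidedIdeal.mul_mem_left _ _ _ (TwoSidedIdeal.sub_mem _ hr ht), ?_⟩
    have h3 : p + -q + (r - t) = algebraMap K _ ((c : K) - b) := by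
      calc p + -q + (r - t) = (p + r) - (q + t) := by abel
        _ = _ := by rw [h1, h2, sub_sub_sub_cancel_left, map_sub]
    rw [← mul_add, ← mul_add, h3, ← map_mul, inv_mul_cancel₀ (sub_ne_zero.2 hbc'.symm), map_one]
  obtain ⟨p, hp, q, hq, r, hr, hpqr⟩ := hone
  refine le_finrank_of_three_maps f₁ f₂ f₃ hs₁ {heckeOrbit n a c 1}
    {heckeOrbit n b c p, heckeOrbit n b c q} (by simp) Finset.card_le_two k₂ ?_
  refine sup_span_eq_top_of_surjective (tripledMk n a b c) _ f₃ hf₃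
    (heckeOrbit_surjective n b c) _ _ fun u => ?_
  obtain ⟨j₁, h₁, j₃, h₃, hu⟩ := hb u
  obtain ⟨j₂, h₂, j₃', h₃', hu'⟩ := hc u
  -- From u = up + uq + ur, the first u is expanded along J_ac + J_bc and the second along J_ab +
  -- J_bc. The terms j₂p and j₁q lie in J_ab ∩ J_ac, those in J_bc vanish under the third map, and
  -- multiples of p and q remain.
  refine ⟨j₂ * p + j₁ * q, ⟨?_, ?_⟩, ?_⟩
  · rw [SetLike.mem_coe, LinearMap.mem_ker, hf₁]
    exact heckeOrbit_eq_zero a b (TwoSidedIdeal.add_mem _ (TwoSidedIdeal.mul_mem_left _ _ _ hp)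
      (TwoSidedIdeal.mul_mem_right _ _ _ h₁))
  · rw [SetLike.mem_coe, LinearMap.mem_ker, hf₂]
    exact heckeOrbit_eq_zero a c (TwoSidedIdeal.add_mem _ (TwoSidedIdeal.mul_mem_right _ _ _ h₂)
      (TwoSidedIdeal.mul_mem_left _ _ _ hq))
  · have e1 : u = algebraMap K _ (character n c u) + j₂ + j₃' := by
      rw [add_assoc, hu', add_sub_cancel]
    have e2 : u = algebraMap K _ (character n b u) + j₁ + j₃ := by
      rw [add_assoc, hu, add_sub_cancel]
    have e : u - (j₂ * p + j₁ * q) = character n c u • p + character n b u • q +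
        (j₃' * p + j₃ * q + u * r) := by
      calc u - (j₂ * p + j₁ * q) = u * p + u * q + u * r - (j₂ * p + j₁ * q) := by
            rw [← mul_add, ← mul_add, hpqr, mul_one]
        _ = (algebraMap K _ (character n c u) + j₂ + j₃') * p +
            (algebraMap K _ (character n b u) + j₁ + j₃) * q + u * r - (j₂ * p + j₁ * q) := by
            rw [← e1, ← e2]
        _ = _ := by
            rw [Algebra.smul_def, Algebra.smul_def]
            simp only [add_mul]
            abel
    rw [← map_sub, e, map_add, heckeOrbit_eq_zero b c (TwoSidedIdeal.add_mem _
      (TwoSidedIdeal.add_mem _ (TwoSidedIdeal.mul_mem_right _ _ _ h₃')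
        (TwoSidedIdeal.mul_mem_right _ _ _ h₃)) (TwoSidedIdeal.mul_mem_left _ _ _ hr)), add_zero,
      map_add, map_smul, map_smul]
    exact Submodule.add_mem _ (Submodule.smul_mem _ _ (Submodule.subset_span (by simp)))
      (Submodule.smul_mem _ _ (Submodule.subset_span (by simp)))

/-- The natural morphism is an isomorphism as soon as the source is small enough. -/
theorem toTripled_bijective_and_finrank {n d : ℕ} {a b c : Kˣ} (hab : a ≠ b) (hac : a ≠ c)
    (hbc : b ≠ c) (hd : d = n.factorial + (n.factorial - 1) + (n.factorial - 2))
    (h : Module.Finite K (KAlg n a b c) ∧ Module.finrank K (KAlg n a b c) ≤ d) :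
    Function.Bijective (toTripled n a b c) ∧ Module.finrank K (KAlg n a b c) = d ∧
      Module.Finite K (Tripled n a b c) ∧ Module.finrank K (Tripled n a b c) = d := by
  obtain ⟨hfin, hle⟩ := h
  have hs := toTripled_surjective n a b c
  have hfin' : Module.Finite K (Tripled n a b c) :=
    Module.Finite.of_surjective (toTripled n a b c).toLinearMap hs
  have h1 := le_finrank_tripled n a b c hab hac hbc
  have h2 := LinearMap.finrank_le_finrank_of_surjective (f := (toTripled n a b c).toLinearMap) hs
  -- Everything is squeezed: d ≤ dim `Tripled` ≤ dim `KAlg` ≤ d.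
  have h3 : Module.finrank K (KAlg n a b c) = Module.finrank K (Tripled n a b c) := by omega
  refine ⟨⟨?_, hs⟩, by omega, hfin', by omega⟩
  exact (LinearMap.injective_iff_surjective_of_finrank_eq_finrank
    (f := (toTripled n a b c).toLinearMap) h3).2 hs

theorem toTripled_bijective {a b c : Kˣ} (hab : a ≠ b) (hac : a ≠ c) (hbc : b ≠ c) (n : ℕ)
    (hn : n ≤ 4) : Function.Bijective (toTripled n a b c) := by
  interval_cases n
  · exact (toTripled_bijective_and_finrank hab hac hbc (by decide)
      (finite_finrank_kAlg_of_le_one 0 (by norm_num) a b c)).1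
  · exact (toTripled_bijective_and_finrank hab hac hbc (by decide)
      (finite_finrank_kAlg_of_le_one 1 le_rfl a b c)).1
  · exact (toTripled_bijective_and_finrank hab hac hbc (by decide)
      (finite_finrank_kAlg_two a b c)).1
  · exact (toTripled_bijective_and_finrank hab hac hbc (by decide)
      (finite_finrank_kAlg_three a b c)).1
  · exact (toTripled_bijective_and_finrank hab hac hbc (by decide)
      (finite_finrank_kAlg_four a b c)).1

end Dimension

/-! ### The image of the representation V. -/

section Representation

variable {K : Type*} [Field K]

theorem V_cubicGen_zero (a b c : Kˣ) :
    V a b c (cubicGen 3 a b c (0 : Fin 2)) = vMatrix₁ (a : K) b c :=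
  vAlg_gen a b c 0

theorem V_cubicGen_one (a b c : Kˣ) :
    V a b c (cubicGen 3 a b c (1 : Fin 2)) = vMatrix₂ (a : K) b c :=
  vAlg_gen a b c 1

/-- A rank one matrix carries a given nonzero vector `w` to any prescribed `v`. -/
theorem isIrreducible_of_surjective {A : Type*} [Ring A] [Algebra K A] {m : ℕ} (hm : 0 < m)
    {ρ : A →ₐ[K] Matrix (Fin m) (Fin m) K} (h : Function.Surjective ρ) : IsIrreducible ρ := by
  refine ⟨hm, fun W hW => or_iff_not_imp_left.2 fun hne => ?_⟩
  obtain ⟨w, hw, hw0⟩ := W.ne_bot_iff.1 hne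
  obtain ⟨j, hj⟩ := Function.ne_iff.1 hw0
  rw [eq_top_iff]
  rintro v -
  obtain ⟨x, hx⟩ := h (Matrix.vecMulVec v (Pi.single j (w j)⁻¹))
  have h1 := hW x w hw
  rw [hx, Matrix.vecMulVec_mulVec, single_dotProduct, inv_mul_cancel₀ hj] at h1
  simpa using h1

/-- The matrix whose first column is `v`, the other columns being zero. -/
def firstColumn (v : Fin 3 → K) : Matrix (Fin 3) (Fin 3) K :=
  Matrix.vecMulVec v ![1, 0, 0]

theorem mul_firstColumn (P : Matrix (Fin 3) (Fin 3) K) (v : Fin 3 → K) :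
    P * firstColumn v = firstColumn (P.mulVec v) := by
  rw [firstColumn, firstColumn, Matrix.mul_vecMulVec]

/-- The vectors `v` such that `firstColumn v` lies in the image of `V`. -/
def firstColumnSpace (a b c : Kˣ) : Submodule K (Fin 3 → K) where
  carrier := {v | ∃ x, V a b c x = firstColumn v}
  zero_mem' := ⟨0, by simp [firstColumn]⟩
  add_mem' := by
    rintro v w ⟨x, hx⟩ ⟨y, hy⟩
    exact ⟨x + y, by rw [map_add, hx, hy, firstColumn, firstColumn, firstColumn,
      Matrix.add_vecMulVec]⟩
  smul_mem' := by
    rintro r v ⟨x, hx⟩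
    exact ⟨r • x, by rw [map_smul, hx, firstColumn, firstColumn, Matrix.smul_vecMulVec]⟩

theorem mulVec_mem_firstColumnSpace (a b c : Kˣ) (x : Cubic 3 a b c) {v : Fin 3 → K}
    (hv : v ∈ firstColumnSpace a b c) : (V a b c x).mulVec v ∈ firstColumnSpace a b c := by
  obtain ⟨y, hy⟩ := hv
  exact ⟨x * y, by rw [map_mul, hy, mul_firstColumn]⟩

/-- The first column of `(s₁ - a)(s₁ - b)` on `V`. -/
def rankOneColumn (a b c : K) : Fin 3 → K :=
  ![(c - a) * (c - b), (a * c + b ^ 2) * (c - a), c * (a + b)]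

/-- The matrix of s₁ is lower triangular and preserves the span of the last two basis vectors, with
eigenvalues b and a there; by Cayley–Hamilton (s₁ - a)(s₁ - b) kills that span, leaving only its
first column. -/
theorem rankOneColumn_mem (a b c : Kˣ) :
    rankOneColumn (a : K) b c ∈ firstColumnSpace a b c := by
  refine ⟨(cubicGen 3 a b c (0 : Fin 2) - algebraMap K _ (a : K)) *
    (cubicGen 3 a b c (0 : Fin 2) - algebraMap K _ (b : K)), ?_⟩
  simp only [map_mul, map_sub, AlgHom.commutes, V_cubicGen_zero]
  ext i j
  fin_cases i <;> fin_cases j <;>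
    simp [vMatrix₁, Matrix.mul_apply, Fin.sum_univ_three, Matrix.algebraMap_matrix_apply,
      firstColumn, rankOneColumn, Matrix.vecMulVec_apply] <;> ring

/-- Right multiplication by s₂ and s₂s₁ turns the row (1, 0, 0) into two further rows, and the three
are independent because ab is nonzero. The vectors chosen below solve for the columns of `X` in this
basis. -/
theorem V_surjective_of_firstColumnSpace_eq_top {a b c : Kˣ} (h : firstColumnSpace a b c = ⊤) :
    Function.Surjective (V a b c) := by
  intro X
  have key : ∀ v, ∃ x, V a b c x = firstColumn v := fun v => by
    have hv : v ∈ firstColumnSpace a b c := h ▸ Submodule.mem_top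
    exact hv
  have ha : (a : K) ≠ 0 := a.ne_zero
  have hb : (b : K) ≠ 0 := b.ne_zero
  -- the rows `(1, 0, 0)`, `(a, -1, b)` and `(0, 0, a b)`
  obtain ⟨x₁, h₁⟩ := key (fun i => X i 0 + a * X i 1)
  obtain ⟨x₂, h₂⟩ := key (fun i => -X i 1)
  obtain ⟨x₃, h₃⟩ := key (fun i => (X i 2 + b * X i 1) * (a * b : K)⁻¹)
  refine ⟨x₁ + x₂ * cubicGen 3 a b c (1 : Fin 2) +
    x₃ * cubicGen 3 a b c (1 : Fin 2) * cubicGen 3 a b c (0 : Fin 2), ?_⟩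
  simp only [map_add, map_mul, h₁, h₂, h₃, V_cubicGen_zero, V_cubicGen_one]
  ext i j
  fin_cases j <;>
    simp [firstColumn, vMatrix₁, vMatrix₂, Matrix.mul_apply, Fin.sum_univ_three,
      Matrix.vecMulVec_apply] <;> field_simp <;> ring

/-- `firstColumnSpace` is invariant, and it is nonzero because the first entry of `rankOneColumn` is
(c - a)(c - b); irreducibility makes it everything. -/
theorem V_surjective_of_isIrreducible {a b c : Kˣ} (hac : a ≠ c) (hbc : b ≠ c)
    (h : IsIrreducible (V a b c)) : Function.Surjective (V a b c) := by
  refine V_surjective_of_firstColumnSpace_eq_top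
    ((h.2 _ fun x w hw => mulVec_mem_firstColumnSpace a b c x hw).resolve_left fun h0 => ?_)
  have h1 := rankOneColumn_mem a b c
  rw [h0, Submodule.mem_bot] at h1
  have h2 := congrFun h1 0
  simp only [rankOneColumn, Matrix.cons_val_zero, Pi.zero_apply, mul_eq_zero, sub_eq_zero] at h2
  rcases h2 with h2 | h2
  · exact hac (Units.ext h2.symm)
  · exact hbc (Units.ext h2.symm)

/-- The determinant of `u`, `s₂ u` and `s₁ s₂ u`, where `u` is the first column of
`(s₁ - a)(s₁ - b)`. -/
def orbitDet (a b c : K) : K :=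
  Matrix.det (Matrix.of ![rankOneColumn a b c, (vMatrix₂ a b c).mulVec (rankOneColumn a b c),
    (vMatrix₁ a b c).mulVec ((vMatrix₂ a b c).mulVec (rankOneColumn a b c))])

theorem orbitDet_eq (a b c : K) : orbitDet a b c =
    a * b * (b ^ 2 + a * c) * (a ^ 2 + b * c) * (c ^ 2 + a * b) ^ 2 := by
  simp [orbitDet, Matrix.det_fin_three, Matrix.mulVec, dotProduct, Fin.sum_univ_three,
    rankOneColumn, vMatrix₁, vMatrix₂]
  ring

end Representation

/-! ### Surjectivity of V, and the action of 𝐛 on it. -/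

section Block

variable {K : Type*} [Field K]

theorem V_surjective_of_orbitDet_ne_zero {a b c : Kˣ} (h : orbitDet (a : K) b c ≠ 0) :
    Function.Surjective (V a b c) := by
  refine V_surjective_of_firstColumnSpace_eq_top ?_
  have h0 := rankOneColumn_mem a b c
  have h1 := mulVec_mem_firstColumnSpace a b c (cubicGen 3 a b c (1 : Fin 2)) h0
  have h2 := mulVec_mem_firstColumnSpace a b c (cubicGen 3 a b c (0 : Fin 2)) h1
  rw [V_cubicGen_one] at h1 h2
  rw [V_cubicGen_zero] at h2
  have hli := Matrix.linearIndependent_rows_of_det_ne_zero h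
  have hspan := hli.span_eq_top_of_card_eq_finrank (by simp)
  rw [eq_top_iff, ← hspan, Submodule.span_le]
  rintro _ ⟨i, rfl⟩
  fin_cases i
  · exact h0
  · exact h1
  · exact h2

/-- The column space becomes an `A`-module through `ρ`. Scalars act through `algebraMap`, so
`A`-submodules are exactly the invariant subspaces, and semisimplicity supplies the complement. -/
theorem exists_isCompl_invariant {A : Type*} [Ring A] [Algebra K A] [IsSemisimpleRing A] {m : ℕ}
    (ρ : A →ₐ[K] Matrix (Fin m) (Fin m) K) (W : Submodule K (Fin m → K))
    (hW : ∀ x, ∀ w ∈ W, (ρ x).mulVec w ∈ W) :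
    ∃ W' : Submodule K (Fin m → K), (∀ x, ∀ w ∈ W', (ρ x).mulVec w ∈ W') ∧ IsCompl W W' := by
  letI : Module A (Fin m → K) :=
    Module.compHom _ ((Matrix.toLinAlgEquiv' : Matrix (Fin m) (Fin m) K ≃ₐ[K] _).toAlgHom.comp
      ρ : A →+* Module.End K (Fin m → K))
  have hsmul : ∀ (x : A) (w : Fin m → K), x • w = (ρ x).mulVec w := fun _ _ => rfl
  have hK : ∀ (r : K) (w : Fin m → K), r • w = algebraMap K A r • w := fun r w => by
    rw [hsmul, AlgHom.commutes, Algebra.algebraMap_eq_smul_one, Matrix.smul_mulVec,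
      Matrix.one_mulVec]
  let U : Submodule A (Fin m → K) :=
    { W.toAddSubmonoid with smul_mem' := fun x w hw => by rw [hsmul]; exact hW x w hw }
  obtain ⟨U', hU'⟩ := exists_isCompl U
  let W' : Submodule K (Fin m → K) :=
    { U'.toAddSubmonoid with smul_mem' := fun r w hw => by rw [hK]; exact U'.smul_mem _ hw }
  refine ⟨W', fun x w hw => ?_, ?_, ?_⟩
  · rw [← hsmul]
    exact U'.smul_mem x hw
  · rw [Submodule.disjoint_def]
    exact fun w hw hw' => Submodule.disjoint_def.1 hU'.disjoint w hw hw'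
  · rw [codisjoint_iff, eq_top_iff]
    rintro w -
    obtain ⟨y, hy, z, hz, rfl⟩ := Submodule.mem_sup.1
      (codisjoint_iff.1 hU'.codisjoint ▸ Submodule.mem_top : w ∈ U ⊔ U')
    exact Submodule.add_mem_sup (S := W) (T := W') hy hz

/-- A scalar commutant obtained without irreducibility. Commuting with the lower triangular s₁ kills
the entries of F above the diagonal, commuting with the upper triangular s₂ those below, by
distinctness of the eigenvalues; the entries 1 and -1 next to the diagonals then equate the diagonal
entries of F. -/
theorem eq_smul_one_of_commute {a b c : K} (hab : a ≠ b) (hac : a ≠ c) (hbc : b ≠ c)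
    {F : Matrix (Fin 3) (Fin 3) K} (h₁ : vMatrix₁ a b c * F = F * vMatrix₁ a b c)
    (h₂ : vMatrix₂ a b c * F = F * vMatrix₂ a b c) : F = F 0 0 • (1 : Matrix (Fin 3) (Fin 3) K) := by
  have e := fun i j => congrFun (congrFun h₁ i) j
  have f := fun i j => congrFun (congrFun h₂ i) j
  simp only [vMatrix₁, vMatrix₂, Matrix.mul_apply, Fin.sum_univ_three] at e f
  have e02 := e 0 2; have e01 := e 0 1; have e12 := e 1 2; have e21 := e 2 1
  have f20 := f 2 0; have f21 := f 2 1; have f10 := f 1 0; have f01 := f 0 1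
  simp at e02 e01 e12 e21 f20 f21 f10 f01
  have F02 : F 0 2 = 0 := by
    have : (c - a) * F 0 2 = 0 := by linear_combination e02
    exact (mul_eq_zero.1 this).resolve_left (sub_ne_zero.2 hac.symm)
  have F01 : F 0 1 = 0 := by
    have : (c - b) * F 0 1 = 0 := by linear_combination e01 + F02
    exact (mul_eq_zero.1 this).resolve_left (sub_ne_zero.2 hbc.symm)
  have F12 : F 1 2 = 0 := by
    have : (b - a) * F 1 2 = 0 := by linear_combination e12 - (a * c + b ^ 2) * F02
    exact (mul_eq_zero.1 this).resolve_left (sub_ne_zero.2 hab.symm)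
  have F20 : F 2 0 = 0 := by
    have : (c - a) * F 2 0 = 0 := by linear_combination f20
    exact (mul_eq_zero.1 this).resolve_left (sub_ne_zero.2 hac.symm)
  have F21 : F 2 1 = 0 := by
    have : (c - b) * F 2 1 = 0 := by linear_combination f21 - F20
    exact (mul_eq_zero.1 this).resolve_left (sub_ne_zero.2 hbc.symm)
  have F10 : F 1 0 = 0 := by
    have : (b - a) * F 1 0 = 0 := by linear_combination f10 + (a * c + b ^ 2) * F20
    exact (mul_eq_zero.1 this).resolve_left (sub_ne_zero.2 hab.symm)
  have F22 : F 2 2 = F 1 1 := by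
    linear_combination -e21 + b * F01 + a * F21 - b * F21
  have F11 : F 1 1 = F 0 0 := by
    linear_combination -f01 + (a - b) * F01 + b * F21
  ext i j
  fin_cases i <;> fin_cases j <;> simp [F02, F01, F12, F20, F21, F10, F22, F11]

/-- Projection onto an invariant subspace along an invariant complement commutes with the action,
hence is a scalar: zero gives the zero subspace, nonzero gives the whole space. -/
theorem isIrreducible_V_of_isSemisimpleRing {a b c : Kˣ} (hab : a ≠ b) (hac : a ≠ c) (hbc : b ≠ c)
    [IsSemisimpleRing (Cubic 3 a b c)] : IsIrreducible (V a b c) := by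
  refine ⟨by norm_num, fun W hW => ?_⟩
  obtain ⟨W', hW', hc⟩ := exists_isCompl_invariant (V a b c) W hW
  set P := W.projection W' hc
  have hP : ∀ x, (V a b c x) * LinearMap.toMatrix' P = LinearMap.toMatrix' P * V a b c x := by
    intro x
    refine Matrix.toLin'.injective (LinearMap.ext fun w => ?_)
    simp only [Matrix.toLin'_mul, Matrix.toLin'_toMatrix', LinearMap.comp_apply, Matrix.toLin'_apply]
    have h1 : w = P w + (w - P w) := by abel
    conv_rhs => rw [h1, Matrix.mulVec_add, map_add]
    rw [Submodule.projection_apply_of_mem_left hc (hW x _ (Submodule.projection_apply_mem hc w)),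
      (Submodule.projection_apply_eq_zero_iff hc).2 (hW' x _ (Submodule.sub_projection_mem hc w)),
      add_zero]
  have hs := eq_smul_one_of_commute (fun h => hab (Units.ext h)) (fun h => hac (Units.ext h))
    (fun h => hbc (Units.ext h)) (V_cubicGen_zero a b c ▸ hP (cubicGen 3 a b c (0 : Fin 2)))
    (V_cubicGen_one a b c ▸ hP (cubicGen 3 a b c (1 : Fin 2)))
  set k := LinearMap.toMatrix' P 0 0
  have hPk : ∀ w, P w = k • w := fun w => by
    have h1 := LinearMap.congr_fun (Matrix.toLin'_toMatrix' P) w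
    rw [hs] at h1
    rw [← h1, Matrix.toLin'_apply, Matrix.smul_mulVec, Matrix.one_mulVec]
  by_cases hk : k = 0
  · left
    refine (Submodule.eq_bot_iff _).2 fun w hw => ?_
    rw [← Submodule.projection_apply_of_mem_left hc hw]
    change P w = 0
    rw [hPk, hk, zero_smul]
  · right
    rw [eq_top_iff]
    rintro w -
    have h1 : P w ∈ W := Submodule.projection_apply_mem hc w
    rw [hPk] at h1
    exact (W.smul_mem_iff hk).1 h1

theorem isSemisimpleRing_of_isSplitSemisimple {A : Type*} [Ring A] [Algebra K A]
    (h : IsSplitSemisimple K A) : IsSemisimpleRing A := by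
  obtain ⟨r, d, -, ⟨e⟩⟩ := h
  exact e.symm.toRingEquiv.isSemisimpleRing

/-- If ac + b² vanished, the off-diagonal entries of the middle row would be zero on both
generators, hence on the whole image. -/
theorem discriminant_ne_zero_of_surjective {a b c : Kˣ} (h : Function.Surjective (V a b c)) :
    (a * c + b ^ 2 : K) ≠ 0 := by
  intro h0
  have key : ∀ x : Cubic 3 a b c, V a b c x 1 0 = 0 ∧ V a b c x 1 2 = 0 := by
    intro x
    have hx : x ∈ Algebra.adjoin K (Set.range (cubicGen 3 a b c)) := by
      rw [adjoin_cubicGen]; trivial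
    induction hx using Algebra.adjoin_induction with
    | mem x hx =>
      obtain ⟨i, rfl⟩ := hx
      change Fin 2 at i
      fin_cases i
      · have := V_cubicGen_zero a b c
        simp only [Fin.zero_eta]
        rw [this]
        simp [vMatrix₁, h0]
      · have := V_cubicGen_one a b c
        simp only [Fin.mk_one]
        rw [this]
        refine ⟨by simp [vMatrix₂], ?_⟩
        simp [vMatrix₂]
        linear_combination -h0
    | algebraMap r => simp [Matrix.algebraMap_matrix_apply]
    | add x y _ _ hx hy => simp [hx, hy]
    | mul x y _ _ hx hy => simp [Matrix.mul_apply, Fin.sum_univ_three, hx, hy]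
  obtain ⟨x, hx⟩ := h (Matrix.single 1 0 1)
  have h1 := (key x).1
  rw [hx] at h1
  simp at h1

theorem V_bElement_ne_zero {a b c : Kˣ} (hac : a ≠ c) (h : Function.Surjective (V a b c)) :
    V a b c (bElement (cubicGen 3 a b c (0 : Fin 2)) (cubicGen 3 a b c (1 : Fin 2))) ≠ 0 := by
  intro h0
  have h1 := map_bElement (V a b c : Cubic 3 a b c →+* Matrix (Fin 3) (Fin 3) K) (cubicGen 3 a b c (0 : Fin 2))
    (cubicGen 3 a b c (1 : Fin 2))
  rw [RingHom.coe_coe, h0, V_cubicGen_zero, V_cubicGen_one] at h1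
  have h2 := congrFun (congrFun h1 0) 0
  -- The left side is the upper left entry of the matrix of 𝐛.
  have h3 : ((c : K) - a) * (a * c + b ^ 2) = 0 := by
    rw [Matrix.zero_apply] at h2
    rw [h2]
    simp [bElement, Ring.lie_def, pow_two, vMatrix₁, vMatrix₂, Matrix.mul_apply,
      Fin.sum_univ_three, -Matrix.cons_mul]
    ring
  rcases mul_eq_zero.1 h3 with h4 | h4
  · exact hac (Units.ext (sub_eq_zero.1 h4).symm)
  · exact discriminant_ne_zero_of_surjective h h4

end Block

/-! ### The central idempotent and the block. -/

section CentralIdempotent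

variable {K : Type*} [Field K]

/-- Over a simple image, the image of a nonzero two-sided ideal contains the identity. -/
theorem exists_mem_span_map_eq_one {A B : Type*} [Ring A] [Ring B] [IsSimpleRing B] (f : A →+* B)
    (hf : Function.Surjective f) {z : A} (hz : f z ≠ 0) :
    ∃ e ∈ TwoSidedIdeal.span {z}, f e = 1 := by
  let I : TwoSidedIdeal B := TwoSidedIdeal.mk' {y | ∃ x ∈ TwoSidedIdeal.span {z}, f x = y}
    ⟨0, TwoSidedIdeal.zero_mem _, map_zero f⟩
    (by
      rintro _ _ ⟨x, hx, rfl⟩ ⟨y, hy, rfl⟩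
      exact ⟨x + y, TwoSidedIdeal.add_mem _ hx hy, map_add f x y⟩)
    (by
      rintro _ ⟨x, hx, rfl⟩
      exact ⟨-x, TwoSidedIdeal.neg_mem _ hx, map_neg f x⟩)
    (by
      rintro y _ ⟨x, hx, rfl⟩
      obtain ⟨y, rfl⟩ := hf y
      exact ⟨y * x, TwoSidedIdeal.mul_mem_left _ _ _ hx, map_mul f y x⟩)
    (by
      rintro _ y ⟨x, hx, rfl⟩
      obtain ⟨y, rfl⟩ := hf y
      exact ⟨x * y, TwoSidedIdeal.mul_mem_right _ _ _ hx, map_mul f x y⟩)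
  have hI : ∀ y, y ∈ I ↔ ∃ x ∈ TwoSidedIdeal.span {z}, f x = y := fun y => by
    simp only [I, TwoSidedIdeal.mem_mk', Set.mem_setOf_eq]
  have htop : I = ⊤ := (eq_bot_or_eq_top I).resolve_left fun h => hz <| by
    have h1 : f z ∈ I := (hI _).2 ⟨z, TwoSidedIdeal.subset_span rfl, rfl⟩
    rwa [h, TwoSidedIdeal.mem_bot] at h1
  exact (hI 1).1 (htop ▸ TwoSidedIdeal.mem_top B)

/-- If `A` is no larger than the product of `T` and a matrix algebra, then an element killed by
`A → T` but not by the matrix representation generates the corresponding block. -/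
theorem isBlockOf_span_singleton {A T : Type*} [Ring A] [Algebra K A] [Ring T] [Algebra K T]
    [Module.Finite K A] [Module.Finite K T] {m : ℕ} (hm : 0 < m)
    (φ : A →ₐ[K] T) (ρ : A →ₐ[K] Matrix (Fin m) (Fin m) K) (hφ : Function.Surjective φ)
    (hρ : Function.Surjective ρ) {z : A} (hφz : φ z = 0) (hρz : ρ z ≠ 0)
    (hd : Module.finrank K A ≤ Module.finrank K T + m * m) :
    IsBlockOf ρ (TwoSidedIdeal.span {z}) := by
  have : Nonempty (Fin m) := ⟨⟨0, hm⟩⟩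
  obtain ⟨e, he, hρe⟩ := exists_mem_span_map_eq_one (ρ : A →+* Matrix (Fin m) (Fin m) K) hρ hρz
  rw [RingHom.coe_coe] at hρe
  have hker : TwoSidedIdeal.span {z} ≤ TwoSidedIdeal.ker (φ : A →+* T) :=
    TwoSidedIdeal.span_le.2 fun y hy => (TwoSidedIdeal.mem_ker _).2 (by
      rw [Set.mem_singleton_iff.1 hy]; exact hφz)
  have hφe : φ e = 0 := (TwoSidedIdeal.mem_ker _).1 (hker he)
  have hinj : Function.Injective (φ.prod ρ) := by
    have hs : Function.Surjective (φ.prod ρ).toLinearMap := by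
      rintro ⟨t, y⟩
      obtain ⟨t, rfl⟩ := hφ t
      obtain ⟨y, rfl⟩ := hρ y
      -- Since `e` maps to (0, 1), this element maps to the given pair.
      refine ⟨t * (1 - e) + y * e, ?_⟩
      simp [hφe, hρe]
    have hdim : Module.finrank K A = Module.finrank K (T × Matrix (Fin m) (Fin m) K) := by
      refine le_antisymm ?_ (LinearMap.finrank_le_finrank_of_surjective hs)
      rw [Module.finrank_prod, Module.finrank_matrix]
      simpa using hd
    exact (LinearMap.injective_iff_surjective_of_finrank_eq_finrank hdim).2 hs
  have hext : ∀ {x y : A}, φ x = φ y → ρ x = ρ y → x = y := fun h1 h2 => hinj (Prod.ext h1 h2)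
  refine ⟨e, ?_, hext (by simp [hφe]) (by simp [hρe]), ?_, ?_, hρe, le_antisymm ?_ ?_⟩
  · exact Subring.mem_center_iff.2 fun x => hext (by simp [hφe]) (by simp [hρe])
  · rintro rfl
    rw [map_zero] at hρe
    exact zero_ne_one hρe
  · intro f hf hff hfe
    have hφf : φ f = 0 := by rw [← hfe, map_mul, hφe, mul_zero]
    -- Primitivity: `f` is killed by `φ`, and `ρ f` is a central idempotent of a matrix algebra,
    -- hence the scalar 0 or 1.
    have hc : ρ f ∈ Set.center (Matrix (Fin m) (Fin m) K) := by
      refine Semigroup.mem_center_iff.2 fun y => ?_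
      obtain ⟨y, rfl⟩ := hρ y
      rw [← map_mul, ← map_mul, Subring.mem_center_iff.1 hf y]
    rw [Matrix.center_eq_range] at hc
    obtain ⟨k, hk⟩ := hc
    have hk2 : k * k = k := by
      have h1 : ρ f * ρ f = ρ f := by rw [← map_mul, hff.eq]
      rw [← hk, ← map_mul] at h1
      exact Matrix.scalar_inj.1 h1
    rcases IsIdempotentElem.iff_eq_zero_or_one.1 hk2 with rfl | rfl
    · left
      exact hext (by rw [hφf, map_zero]) (by rw [← hk, map_zero, map_zero])
    · right
      exact hext (by rw [hφf, hφe]) (by rw [← hk, map_one, hρe])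
  · refine TwoSidedIdeal.span_le.2 fun y hy => ?_
    rw [Set.mem_singleton_iff.1 hy]
    have hz : z = z * e := hext (by simp [hφz]) (by simp [hρe])
    rw [SetLike.mem_coe, hz]
    exact TwoSidedIdeal.mul_mem_left _ _ _ (TwoSidedIdeal.subset_span rfl)
  · exact TwoSidedIdeal.span_le.2 fun y hy => by
      rw [Set.mem_singleton_iff.1 hy]; exact he

/-- The dimension count is 24 = 15 + 3 · 3, with `Tripled 3` as the complementary factor. -/
theorem isBlockOf_V {a b c : Kˣ} (hab : a ≠ b) (hac : a ≠ c) (hbc : b ≠ c)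
    (h : Function.Surjective (V a b c)) :
    IsBlockOf (V a b c) (TwoSidedIdeal.span {bElement (cubicGen 3 a b c (0 : Fin 2))
      (cubicGen 3 a b c (1 : Fin 2))}) := by
  obtain ⟨hfin, hle⟩ := finite_finrank_cubic_three a b c
  obtain ⟨-, -, hfinT, hT⟩ := toTripled_bijective_and_finrank hab hac hbc (by decide)
    (finite_finrank_kAlg_three a b c)
  exact isBlockOf_span_singleton (by norm_num) (cubicToTripled 3 a b c) (V a b c)
    (cubicToTripled_surjective 3 a b c) h (cubicToTripled_bElement 3 a b c _ _)
    (V_bElement_ne_zero hac h) (by rw [hT]; exact hle)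

end CentralIdempotent

/-! ### Consequences of genericity. -/

section Generic

variable {K : Type*} [Field K] [CharZero K]

open MvPolynomial in
/-- A polynomial with rational coefficients which does not vanish at some rational point does not
vanish at algebraically independent elements. -/
theorem aeval_ne_zero_of_eval_ne_zero {ι : Type*} {x : ι → K} (hx : AlgebraicIndependent ℚ x)
    (P : MvPolynomial ι ℚ) (q : ι → ℚ) (h : eval q P ≠ 0) : aeval x P ≠ 0 := fun h0 => h <| by
  rw [(algebraicIndependent_iff.1 hx) P h0, map_zero]

open MvPolynomial in
-- The differences of parameters and the nontrivial factors of `orbitDet` are rational polynomials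
-- that do not vanish at (1, 2, 3), so they do not vanish at algebraically independent elements.
theorem distinct_and_surjective_of_algebraicIndependent {a b c : Kˣ}
    (h : AlgebraicIndependent ℚ ![(a : K), (b : K), (c : K)]) :
    (a ≠ b ∧ a ≠ c ∧ b ≠ c) ∧ Function.Surjective (V a b c) := by
  have key : ∀ P : MvPolynomial (Fin 3) ℚ, eval ![1, 2, 3] P ≠ 0 →
      aeval ![(a : K), (b : K), (c : K)] P ≠ 0 :=
    fun P => aeval_ne_zero_of_eval_ne_zero h P ![1, 2, 3]
  have hab := key (X 0 - X 1) (by simp <;> norm_num)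
  have hac := key (X 0 - X 2) (by simp <;> norm_num)
  have hbc := key (X 1 - X 2) (by simp <;> norm_num)
  have hB := key (X 1 ^ 2 + X 0 * X 2) (by simp <;> norm_num)
  have hA := key (X 0 ^ 2 + X 1 * X 2) (by simp <;> norm_num)
  have hC := key (X 2 ^ 2 + X 0 * X 1) (by simp <;> norm_num)
  simp at hab hac hbc hA hB hC
  refine ⟨⟨fun h => hab (by rw [h, sub_self]), fun h => hac (by rw [h, sub_self]),
    fun h => hbc (by rw [h, sub_self])⟩, V_surjective_of_orbitDet_ne_zero ?_⟩
  rw [orbitDet_eq]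
  exact mul_ne_zero (mul_ne_zero (mul_ne_zero (mul_ne_zero a.ne_zero b.ne_zero) hB) hA)
    (pow_ne_zero 2 hC)

theorem distinct_and_surjective_of_isGeneric {a b c : Kˣ} (h : IsGeneric a b c) :
    (a ≠ b ∧ a ≠ c ∧ b ≠ c) ∧ Function.Surjective (V a b c) := by
  rcases h with h | ⟨⟨hab, hac, hbc⟩, h3, -⟩
  · exact distinct_and_surjective_of_algebraicIndependent h
  · have := isSemisimpleRing_of_isSplitSemisimple h3
    exact ⟨⟨hab, hac, hbc⟩, V_surjective_of_isIrreducible hac hbc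
      (isIrreducible_V_of_isSemisimpleRing hab hac hbc)⟩

end Generic

end CubicHecke

end

/-! ### The main theorem. -/

theorem mainTheorem8 {K : Type*} [Field K] [CharZero K] (a b c : Kˣ)
    (hgen : CubicHecke.IsGeneric a b c) :
    (CubicHecke.IsIrreducible (CubicHecke.V a b c) ∧
      CubicHecke.IsBlockOf (CubicHecke.V a b c)
        (TwoSidedIdeal.span {CubicHecke.bElement (CubicHecke.cubicGen 3 a b c (0 : Fin 2))
          (CubicHecke.cubicGen 3 a b c (1 : Fin 2))})) ∧
    (∀ n : ℕ, n ≤ 4 → Function.Bijective (CubicHecke.toTripled n a b c)) ∧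
    Module.finrank K (CubicHecke.KAlg 3 a b c) = 15 ∧
    Module.finrank K (CubicHecke.KAlg 4 a b c) = 69 ∧
    CubicHecke.Relations₃ (a : K) b c (CubicHecke.kGen 3 a b c (0 : Fin 2))
      (CubicHecke.kGen 3 a b c (1 : Fin 2)) ∧
    CubicHecke.Relations₄ (a : K) b c (CubicHecke.kGen 4 a b c (0 : Fin 3))
      (CubicHecke.kGen 4 a b c (1 : Fin 3)) (CubicHecke.kGen 4 a b c (2 : Fin 3)) := by
  obtain ⟨⟨hab, hac, hbc⟩, hV⟩ := CubicHecke.distinct_and_surjective_of_isGeneric hgen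
  exact ⟨⟨CubicHecke.isIrreducible_of_surjective (by norm_num) hV,
      CubicHecke.isBlockOf_V hab hac hbc hV⟩,
    CubicHecke.toTripled_bijective hab hac hbc,
    (CubicHecke.toTripled_bijective_and_finrank hab hac hbc (by decide)
      (CubicHecke.finite_finrank_kAlg_three a b c)).2.1,
    (CubicHecke.toTripled_bijective_and_finrank hab hac hbc (by decide)
      (CubicHecke.finite_finrank_kAlg_four a b c)).2.1,
    CubicHecke.relations₃_of_threeRules (CubicHecke.kGen_cubic 3 a b c (0 : Fin 2))
      (CubicHecke.kGen_cubic 3 a b c (1 : Fin 2)) (CubicHecke.threeRules_kGen 3 a b c le_rfl)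
      (CubicHecke.bElement_kGen 3 a b c le_rfl),
    CubicHecke.relations₄_of_fourRules (CubicHecke.fourRules_kGen a b c)⟩
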